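/- Write $\rho_0(w)=|w|^{-2}$, $dA=\frac{dx\,dy}{\pi}$, and let $\oint$ denote the contour integral divided by $2\pi i$. Let $\Omega\subsetneq\hat{\mathbb C}$ be a domain (a connected open subset of the Riemann sphere, not the whole sphere) with $\Omega=\operatorname{Int}(\operatorname{Cl}\Omega)$, with $0,\infty\notin\partial\Omega$, and whose boundary is rectifiable (of finite length); $\partial\Omega$ is oriented positively with respect to $\Omega$, i.e. $\int_{\partial\Omega}\varphi\,dw=2i\int_\Omega\frac{\partial\varphi}{\partial\bar w}\,dx\,dy$ for all $\varphi\in C_c^\infty(\mathbb C)$. Let $L^1_a(\Omega;\rho_0)$ be the set of functions $f$ that are holomorphic in $\Omega$, continuous on $\operatorname{Cl}(\Omega)$ and satisfy $\int_\Omega|f|\rho_0\,dA<\infty$. For a rational function $h$, write $\Omega\in QD_0(h)$, and call $h$ a quadrature function of $\Omega$, if all poles of $h$ in $\hat{\mathbb C}$ lie in $\Omega$, if moreover $h(\infty)=0$ in case $\Omega$ is bounded, and if $$\int_\Omega\frac{f(w)}{|w|^2}\,dA(w)=\oint_{\partial\Omega}f(w)h(w)\,dw\qquad\text{for all } f\in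 L^1_a(\Omega;\rho_0).$$ If $0\in\Omega$ and $\Omega\in QD_0(h)$, then $h$ is unique modulo the addition of a point charge $\frac qw$ at the origin; precisely, $$\{\tilde h:\Omega\in QD_0(\tilde h)\}=\left\{h(w)+\frac qw: q\in\mathbb C\right\}.$$ -/

import Mathlib

open MeasureTheory

/-- The Riemann sphere. -/
abbrev RSphere : Type := OnePoint ℂ

/-- The part of a subset of the sphere that lies in the finite plane. -/
def planePart (S : Set RSphere) : Set ℂ := {w : ℂ | (w : RSphere) ∈ S}

open Classical in
/-- The coordinate `z = 1 / w` of the sphere at infinity: `z ↦ 1 / z`, with `0 ↦ ∞`. -/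
noncomputable def chartAtInfinity (z : ℂ) : RSphere :=
  if z = 0 then OnePoint.infty else ((z⁻¹ : ℂ) : RSphere)

/-- `f` is holomorphic on the open subset `Ω` of the sphere: complex differentiable at the finite
points and, if `∞ ∈ Ω`, in the coordinate `1 / w` at `∞`. -/
def IsHolomorphicOn (Ω : Set RSphere) (f : RSphere → ℂ) : Prop :=
  (∀ w : ℂ, (w : RSphere) ∈ Ω → DifferentiableAt ℂ (fun z : ℂ => f (z : RSphere)) w) ∧
  (OnePoint.infty ∈ Ω → DifferentiableAt ℂ (fun z : ℂ => f (chartAtInfinity z)) 0)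

/-- The class `A(Ω)`: holomorphic in `Ω` and continuous on its closure (in the sphere). -/
def MemA (Ω : Set RSphere) (f : RSphere → ℂ) : Prop :=
  IsHolomorphicOn Ω f ∧ ContinuousOn f (closure Ω)

/-- The test class `L_a^1(Ω; ρ₀)`, `ρ₀(w) = |w|⁻²`: the functions in `A(Ω)` that are integrable
over `Ω` against `|w|⁻² dA`. -/
def MemLa1 (Ω : Set RSphere) (f : RSphere → ℂ) : Prop :=
  MemA Ω f ∧ IntegrableOn (fun w : ℂ => f (w : RSphere) / ((‖w‖ ^ 2 : ℝ) : ℂ)) (planePart Ω)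

/-- `∫_Ω f |w|⁻² dA` with `dA = dx dy / π`. -/
noncomputable def logWeightedIntegral (Ω : Set RSphere) (f : RSphere → ℂ) : ℂ :=
  (1 / (Real.pi : ℂ)) * ∫ w in planePart Ω, f (w : RSphere) / ((‖w‖ ^ 2 : ℝ) : ℂ)

/-- `∂φ/∂w̄ = (∂φ/∂x + i ∂φ/∂y) / 2`. -/
noncomputable def dbar (φ : ℂ → ℂ) (w : ℂ) : ℂ :=
  (fderiv ℝ φ w 1 + Complex.I * fderiv ℝ φ w Complex.I) / 2

/-- The boundary of `Ω` has finite length (one-dimensional Hausdorff measure). -/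
def HasRectifiableBoundary (Ω : Set RSphere) : Prop :=
  (Measure.hausdorffMeasure 1 : Measure ℂ) (planePart (frontier Ω)) < ⊤

/-- `T` is the unit tangent field along `∂Ω` for the positive orientation (`Ω` on the left), in the
sense of the Gauss-Green theorem for open sets whose boundary has finite length: `dw = T ds` on
`∂Ω`, where `ds` is arc length, so that
`∫_{∂Ω} φ dw = ∫_{∂Ω} φ T ds = 2 i ∫_Ω (∂φ/∂w̄) dx dy` for all test functions `φ`.
This determines `T` up to a set of length zero. If `∂Ω` consists of rectifiable Jordan curves, `T`
is the usual tangent of their arc length parametrization. Points of `∂Ω` that have `Ω` on both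
sides carry `T = 0`, since there the two passages of the contour cancel. -/
structure IsPositiveTangent (Ω : Set RSphere) (T : ℂ → ℂ) : Prop where
  measurable : Measurable T
  norm_le_one : ∀ w, ‖T w‖ ≤ 1
  green : ∀ φ : ℂ → ℂ, ContDiff ℝ (⊤ : ℕ∞) φ → HasCompactSupport φ →
    ∫ w in planePart (frontier Ω), φ w * T w ∂(Measure.hausdorffMeasure 1 : Measure ℂ) =
      2 * Complex.I * ∫ w in planePart Ω, dbar φ w

/-- `I = ∮_{∂Ω} F(w) dw`, the contour integral over the positively oriented boundary, normalized
by the factor `1 / (2 π i)`. -/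
def HasContourIntegral (Ω : Set RSphere) (F : ℂ → ℂ) (I : ℂ) : Prop :=
  ∃ T : ℂ → ℂ, IsPositiveTangent Ω T ∧
    IntegrableOn (fun w => F w * T w) (planePart (frontier Ω))
      (Measure.hausdorffMeasure 1 : Measure ℂ) ∧
    I = (1 / (2 * (Real.pi : ℂ) * Complex.I)) *
      ∫ w in planePart (frontier Ω), F w * T w ∂(Measure.hausdorffMeasure 1 : Measure ℂ)

/-- `h ∈ Rat(Ω)`: all poles of the rational function `h`, including a possible pole at `∞`, lie
in `Ω`. -/
def MemRat (Ω : Set RSphere) (h : RatFunc ℂ) : Prop :=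
  (∀ w : ℂ, h.denom.IsRoot w → (w : RSphere) ∈ Ω) ∧
  (h.denom.degree < h.num.degree → OnePoint.infty ∈ Ω)

/-- `h(∞) = 0`. -/
def VanishesAtInfinity (h : RatFunc ℂ) : Prop := h.num.degree < h.denom.degree

/-- `Ω ∈ QD₀(h)`: the domain `Ω` of the sphere is a log-weighted quadrature domain with quadrature
function `h`. As `∞ ∉ ∂Ω`, the domain is bounded if `∞ ∉ Ω` and unbounded if `∞ ∈ Ω`; thus
`h ∈ Rat₀(Ω)` is required in the first case and `h ∈ Rat(Ω)` in the second. -/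
structure IsLQD (Ω : Set RSphere) (h : RatFunc ℂ) : Prop where
  isOpen : IsOpen Ω
  isConnected : IsConnected Ω
  interior_closure : interior (closure Ω) = Ω
  zero_notMem : ((0 : ℂ) : RSphere) ∉ frontier Ω
  infty_notMem : OnePoint.infty ∉ frontier Ω
  rectifiable : HasRectifiableBoundary Ω
  memRat : MemRat Ω h
  vanishes : OnePoint.infty ∉ Ω → VanishesAtInfinity h
  quadrature : ∀ f : RSphere → ℂ, MemLa1 Ω f →
    HasContourIntegral Ω (fun w => f (w : RSphere) * h.eval (RingHom.id ℂ) w)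
      (logWeightedIntegral Ω f)

open Filter Topology Metric Set

open scoped ContDiff

/-! ### The operator `∂/∂w̄` -/

/-! Green's formula determines the tangent `T` almost everywhere (`IsLQD.tangent_ae_eq`), so two
quadrature functions can be compared along the same `T`. Their difference k is a rational function
with poles in Ω and ∮ f k dw = 0 for every test function f; the point is that this orthogonality
singles out the multiples of 1 / w.

A point charge is invisible because integrability against |w|⁻² makes f vanish at 0 and, if ∞ ∈ Ω,
at ∞, so f / w has no residue in Ω. The proof uses the integrability directly: cutting f / w off to
growing annuli, with |∂χ/∂w̄| ≤ B / |w|, costs an error dominated by B |f| |w|⁻², which tends to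
zero (`GreenTangent.integral_eq_zero`). Green's formula is given for smooth functions only, while f
is merely continuous up to a boundary of finite length. `GreenTangent.norm_integral_le` bridges this
gap: near ∂Ω the function is replaced by constants on small balls. Each ball costs oscillation times
radius, and finite length bounds the sum of the radii however small the balls are.

Conversely, Ω = Int Cl Ω leaves a finite point z outside the closure, and P(w) / (w - z)^M with P(0)
= 0 and deg P < M is a test function (`exists_memLa1_eq`). If k has a pole p ≠ 0, or a multiple pole
p = 0, some such P cancels the denominator of k up to a simple pole at p, and the nonzero residue
contradicts orthogonality; the constraint P(0) = 0 spares exactly a simple pole at 0. Hence k = m /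
w with a polynomial m (`denom_dvd_X`). If ∞ ∈ Ω, one more test function isolates the leading
coefficient of m and forces m to be constant (`natDegree_eq_zero_of_infty_mem`); otherwise k(∞) = 0
does.

The residue theorem is reduced to one fact, that ∮ (1 / (w - p) - 1 / (w - z)) dw ≠ 0 for p in Ω. It
follows from a smoothed Cauchy kernel whose ∂/∂w̄ is a positive bump with mass bounded below. -/

theorem dbar_fun_mul {f g : ℂ → ℂ} {x : ℂ} (hf : DifferentiableAt ℝ f x)
    (hg : DifferentiableAt ℝ g x) :
    dbar (fun z => f z * g z) x = f x * dbar g x + g x * dbar f x := by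
  simp only [dbar, fderiv_fun_mul hf hg, add_apply,
    smul_apply, smul_eq_mul]
  ring

theorem dbar_fun_add {f g : ℂ → ℂ} {x : ℂ} (hf : DifferentiableAt ℝ f x)
    (hg : DifferentiableAt ℝ g x) :
    dbar (fun z => f z + g z) x = dbar f x + dbar g x := by
  simp only [dbar, fderiv_fun_add hf hg, add_apply]
  ring

theorem dbar_fun_sub {f g : ℂ → ℂ} {x : ℂ} (hf : DifferentiableAt ℝ f x)
    (hg : DifferentiableAt ℝ g x) :
    dbar (fun z => f z - g z) x = dbar f x - dbar g x := by
  simp only [dbar, fderiv_fun_sub hf hg, sub_apply]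
  ring

theorem dbar_const (c x : ℂ) : dbar (fun _ => c) x = 0 := by
  simp [dbar]

theorem dbar_eq_zero_of_differentiableAt {f : ℂ → ℂ} {x : ℂ} (hf : DifferentiableAt ℂ f x) :
    dbar f x = 0 := by
  have h := (hf.hasFDerivAt.restrictScalars ℝ).fderiv
  have h1 : fderiv ℂ f x Complex.I = Complex.I * fderiv ℂ f x 1 := by
    simpa only [smul_eq_mul, mul_one] using (fderiv ℂ f x).map_smul Complex.I 1
  simp only [dbar, h, ContinuousLinearMap.coe_restrictScalars', h1]
  rw [← mul_assoc, Complex.I_mul_I]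
  ring

theorem Filter.EventuallyEq.dbar_eq {f g : ℂ → ℂ} {x : ℂ} (h : f =ᶠ[𝓝 x] g) :
    dbar f x = dbar g x := by
  simp only [dbar, h.fderiv_eq]

theorem ContDiff.continuous_dbar {f : ℂ → ℂ} (hf : ContDiff ℝ ∞ f) : Continuous (dbar f) := by
  have h : Continuous (fderiv ℝ f) := hf.continuous_fderiv (by simp)
  unfold dbar
  fun_prop

theorem HasCompactSupport.dbar {f : ℂ → ℂ} (hf : HasCompactSupport f) :
    HasCompactSupport (dbar f) := by
  refine (hf.fderiv (𝕜 := ℝ)).mono' fun x hx => ?_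
  contrapose! hx
  have h : fderiv ℝ f x = 0 := image_eq_zero_of_notMem_tsupport hx
  simp [_root_.dbar, h]

theorem dbar_comp_affine {f : ℂ → ℂ} (hf : Differentiable ℝ f) (r : ℝ) (a x : ℂ) :
    dbar (fun z => f ((r : ℂ) * (z - a))) x = r * dbar f (r * (x - a)) := by
  have h1 : HasFDerivAt (fun z : ℂ => (r : ℂ) * (z - a))
      (r • ContinuousLinearMap.id ℝ ℂ) x := by
    have := ((hasFDerivAt_id (𝕜 := ℝ) x).sub_const a).const_smul r
    simpa using! this
  have h2 := ((hf (r * (x - a))).hasFDerivAt.comp x h1).fderiv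
  have h3 : fderiv ℝ (fun z => f ((r : ℂ) * (z - a))) x
      = (fderiv ℝ f (r * (x - a))).comp (r • ContinuousLinearMap.id ℝ ℂ) := h2
  simp only [dbar, h3, ContinuousLinearMap.comp_apply, smul_apply,
    ContinuousLinearMap.id_apply, (fderiv ℝ f (r * (x - a))).map_smul]
  simp only [Complex.real_smul]
  ring

/-! ### Standard bump functions -/

/-- A real bump function, equal to `1` on the closed unit disc and supported in the disc of
radius `2`. -/
noncomputable def realBump : ContDiffBump (0 : ℂ) := ⟨1, 2, one_pos, one_lt_two⟩

/-- `realBump` as a complex-valued function. -/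
noncomputable def stdBump (z : ℂ) : ℂ := (realBump z : ℂ)

theorem contDiff_stdBump : ContDiff ℝ ∞ stdBump :=
  Complex.ofRealCLM.contDiff.comp realBump.contDiff

theorem stdBump_eq_one {z : ℂ} (hz : ‖z‖ ≤ 1) : stdBump z = 1 := by
  have : realBump z = 1 := realBump.one_of_mem_closedBall (by simpa [realBump] using hz)
  simp [stdBump, this]

theorem stdBump_eq_zero {z : ℂ} (hz : 2 ≤ ‖z‖) : stdBump z = 0 := by
  have : realBump z = 0 := realBump.zero_of_le_dist (by simpa [realBump] using hz)
  simp [stdBump, this]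

theorem hasCompactSupport_stdBump : HasCompactSupport stdBump :=
  realBump.hasCompactSupport.comp_left (g := fun t : ℝ => (t : ℂ)) (by simp)

theorem exists_norm_dbar_stdBump_le : ∃ B : ℝ, 0 < B ∧ ∀ z, ‖dbar stdBump z‖ ≤ B := by
  obtain ⟨C, hC⟩ := hasCompactSupport_stdBump.dbar.exists_bound_of_continuous
    contDiff_stdBump.continuous_dbar
  exact ⟨max C 1, by positivity, fun z => (hC z).trans (le_max_left _ _)⟩

theorem dbar_stdBump_eq_zero_of_gt {z : ℂ} (hz : 2 < ‖z‖) : dbar stdBump z = 0 := by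
  have : stdBump =ᶠ[𝓝 z] fun _ => 0 := by
    filter_upwards [continuous_norm.tendsto z |>.eventually (lt_mem_nhds hz)] with w hw
    exact stdBump_eq_zero hw.le
  rw [this.dbar_eq, dbar_const]

/-- Convexity: the bump takes values in [0, 1]. The bound on `B` is only needed where the bump may
be nonzero. -/
theorem norm_stdBump_smul_add_le {z A B : ℂ} {η : ℝ} (hA : ‖A‖ ≤ η)
    (hB : ‖z‖ < 2 → ‖B‖ ≤ η) : ‖(1 - stdBump z) * A + stdBump z * B‖ ≤ η := by
  rcases lt_or_ge ‖z‖ 2 with h | h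
  · have h0 := realBump.nonneg (x := z)
    have h1 := realBump.le_one (x := z)
    have e1 : ‖1 - stdBump z‖ = 1 - realBump z := by
      rw [stdBump, ← Complex.ofReal_one, ← Complex.ofReal_sub, Complex.norm_real,
        Real.norm_of_nonneg (by linarith)]
    have e2 : ‖stdBump z‖ = realBump z := by
      rw [stdBump, Complex.norm_real, Real.norm_of_nonneg h0]
    refine (norm_add_le _ _).trans ?_
    rw [norm_mul, norm_mul, e1, e2]
    nlinarith [hB h]
  · simpa [stdBump_eq_zero h] using hA

theorem norm_one_sub_stdBump_le (z : ℂ) : ‖1 - stdBump z‖ ≤ 1 := by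
  have h := norm_stdBump_smul_add_le (z := z) (A := 1) (B := 0) (η := 1) (by simp) (by simp)
  simpa using h

theorem norm_stdBump_le (z : ℂ) : ‖stdBump z‖ ≤ 1 := by
  have h := norm_stdBump_smul_add_le (z := z) (A := 0) (B := 1) (η := 1) (by simp) (by simp)
  simpa using h

/-! ### Coverings of sets of finite length -/

/-- Near-optimal covers in the definition of Hausdorff measure, with each piece fattened to a ball
and compactness applied. What matters is that `C` does not depend on `δ`. -/
theorem exists_finite_ball_cover {K : Set ℂ} (hK : IsCompact K)
    (hfin : (Measure.hausdorffMeasure 1 : Measure ℂ) K < ⊤) :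
    ∃ C : ℝ, 0 < C ∧ ∀ δ > 0, ∃ (J : Finset ℕ) (a : ℕ → ℂ) (r : ℕ → ℝ),
      (∀ n ∈ J, a n ∈ K ∧ 0 < r n ∧ r n < δ) ∧ (K ⊆ ⋃ n ∈ J, ball (a n) (r n)) ∧
      ∑ n ∈ J, r n ≤ C := by
  set H := (Measure.hausdorffMeasure 1 : Measure ℂ) K with hH
  -- The diameters of a near-optimal cover sum to at most H + 1; the enlargements ε / 2ⁿ below add
  -- at most 2.
  refine ⟨H.toReal + 3, by positivity, fun δ hδ => ?_⟩
  have hlt : (⨅ (t : ℕ → Set ℂ) (_ : K ⊆ ⋃ n, t n)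
      (_ : ∀ n, ediam (t n) ≤ ENNReal.ofReal (δ / 2)),
      ∑' n, ⨆ _ : (t n).Nonempty, ediam (t n) ^ (1 : ℝ)) < H + 1 := by
    refine lt_of_le_of_lt ?_ (ENNReal.lt_add_right hfin.ne one_ne_zero)
    rw [hH, Measure.hausdorffMeasure_apply]
    exact le_iSup₂_of_le (ENNReal.ofReal (δ / 2)) (by simpa using hδ) le_rfl
  simp only [iInf_lt_iff] at hlt
  obtain ⟨t, htK, htδ, hts⟩ := hlt
  have hbdd : ∀ n, Bornology.IsBounded (t n) := fun n =>
    isBounded_iff_ediam_ne_top.2 (ne_top_of_le_ne_top ENNReal.ofReal_ne_top (htδ n))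
  have hdiam : ∀ n, diam (t n) ≤ δ / 2 := fun n =>
    ENNReal.toReal_le_of_le_ofReal (by positivity) (htδ n)
  -- The summand ε / 2ⁿ makes radii positive and balls open even for pieces of diameter 0; δ / 4
  -- keeps the radii below δ.
  set ε : ℝ := min (δ / 4) 1 with hε
  have hε0 : 0 < ε := by positivity
  set r : ℕ → ℝ := fun n => diam (t n) + ε * (1 / 2) ^ n with hr
  set I : Set ℕ := {n | (t n ∩ K).Nonempty} with hI
  have hch : ∀ n, ∃ x, n ∈ I → x ∈ t n ∩ K := fun n => by
    by_cases h : n ∈ I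
    · exact ⟨h.some, fun _ => h.some_mem⟩
    · exact ⟨0, fun h' => absurd h' h⟩
  choose a ha using hch
  obtain ⟨b, hbI, hbf, hbK⟩ := hK.elim_finite_subcover_image (b := I)
    (c := fun n => ball (a n) (r n)) (fun n _ => isOpen_ball) (by
      intro x hx
      obtain ⟨n, hn⟩ := mem_iUnion.1 (htK hx)
      have hnI : n ∈ I := ⟨x, hn, hx⟩
      refine mem_iUnion₂.2 ⟨n, hnI, ?_⟩
      have h1 := dist_le_diam_of_mem (hbdd n) hn (ha n hnI).1
      rw [mem_ball]
      have : 0 < ε * (1 / 2) ^ n := by positivity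
      simp only [hr]
      linarith)
  refine ⟨hbf.toFinset, a, r, fun n hn => ?_, by simpa using hbK, ?_⟩
  · refine ⟨(ha n (hbI (hbf.mem_toFinset.1 hn))).2, ?_, ?_⟩
    · have : 0 < ε * (1 / 2) ^ n := by positivity
      have := diam_nonneg (s := t n)
      simp only [hr]
      linarith
    · have h1 : ε * (1 / 2) ^ n ≤ ε * 1 :=
        mul_le_mul_of_nonneg_left (pow_le_one₀ (by norm_num) (by norm_num)) hε0.le
      have h2 : ε ≤ δ / 4 := min_le_left _ _
      have h3 := hdiam n
      simp only [hr]
      linarith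
  · have h1 : ∑ n ∈ hbf.toFinset, diam (t n) ≤ H.toReal + 1 := by
      have h2 : ∑ n ∈ hbf.toFinset, ediam (t n) ≤ H + 1 := by
        refine le_trans ?_ ((ENNReal.sum_le_tsum hbf.toFinset).trans hts.le)
        refine Finset.sum_le_sum fun n hn => ?_
        have hne : (t n).Nonempty := ((hbI (hbf.mem_toFinset.1 hn)).mono inter_subset_left)
        rw [iSup_pos hne, ENNReal.rpow_one]
      have h3 := ENNReal.toReal_mono (by simp [hfin.ne]) h2
      rw [ENNReal.toReal_sum (fun n _ => isBounded_iff_ediam_ne_top.1 (hbdd n)),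
        ENNReal.toReal_add hfin.ne ENNReal.one_ne_top] at h3
      simpa [diam] using h3
    have h2 : ∑ n ∈ hbf.toFinset, ε * (1 / 2 : ℝ) ^ n ≤ 2 := by
      rw [← Finset.mul_sum]
      have h4 : ∑ n ∈ hbf.toFinset, (1 / 2 : ℝ) ^ n ≤ 2 := by
        exact (summable_geometric_two.sum_le_tsum _ (fun _ _ => by positivity)).trans
          tsum_geometric_two.le
      have h5 : ε ≤ 1 := min_le_right _ _
      have h6 : 0 ≤ ∑ n ∈ hbf.toFinset, (1 / 2 : ℝ) ^ n := by positivity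
      nlinarith
    simp only [hr, Finset.sum_add_distrib]
    linarith

/-! ### Green's formula for functions continuous up to the boundary -/

/-- `U` is an open subset of the plane with compact boundary of finite length, and `T` is a tangent
field on the boundary for which Green's formula holds. -/
structure GreenTangent (U : Set ℂ) (T : ℂ → ℂ) : Prop where
  isOpen : IsOpen U
  isCompact_frontier : IsCompact (frontier U)
  hausdorffMeasure_lt_top : (Measure.hausdorffMeasure 1 : Measure ℂ) (frontier U) < ⊤
  measurable : Measurable T
  norm_le_one : ∀ w, ‖T w‖ ≤ 1
  green : ∀ φ : ℂ → ℂ, ContDiff ℝ ∞ φ → HasCompactSupport φ →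
    ∫ w in frontier U, φ w * T w ∂(Measure.hausdorffMeasure 1 : Measure ℂ) =
      2 * Complex.I * ∫ w in U, dbar φ w

theorem integrableOn_mul_of_isCompact {K : Set ℂ} (hK : IsCompact K) {μ : Measure ℂ}
    (hfin : μ K < ⊤) {F T : ℂ → ℂ} (hF : ContinuousOn F K) (hT : Measurable T)
    (hT1 : ∀ w, ‖T w‖ ≤ 1) : IntegrableOn (fun w => F w * T w) K μ := by
  obtain ⟨C, hC⟩ := hK.exists_bound_of_continuousOn hF
  have : IsFiniteMeasure (μ.restrict K) := ⟨by simpa using hfin⟩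
  refine Integrable.of_bound
    ((hF.aestronglyMeasurable hK.measurableSet).mul hT.aestronglyMeasurable) C ?_
  refine (ae_restrict_iff' hK.measurableSet).2 (Eventually.of_forall fun w hw => ?_)
  rw [norm_mul]
  nlinarith [hC w hw, hT1 w, norm_nonneg (F w), norm_nonneg (T w)]

theorem GreenTangent.integrableOn {U : Set ℂ} {T F : ℂ → ℂ} (h : GreenTangent U T)
    (hF : ContinuousOn F (frontier U)) :
    IntegrableOn (fun w => F w * T w) (frontier U) (Measure.hausdorffMeasure 1 : Measure ℂ) :=
  integrableOn_mul_of_isCompact h.isCompact_frontier h.hausdorffMeasure_lt_top hF h.measurable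
    h.norm_le_one

theorem contDiff_stdBump_affine (r : ℝ) (a : ℂ) :
    ContDiff ℝ ∞ (fun z => stdBump ((r : ℂ) * (z - a))) :=
  contDiff_stdBump.comp (contDiff_const.mul (contDiff_id.sub contDiff_const))

/-- Replacing a function near the boundary by local constants, at a cost in `∂/∂w̄` that is
controlled by the oscillation `η`. -/
theorem exists_locally_constant_patch {U : Set ℂ} {F : ℂ → ℂ} {η : ℝ} (hη : 0 ≤ η)
    (J : Finset ℕ) (a : ℕ → ℂ) (r : ℕ → ℝ) (hr : ∀ n ∈ J, 0 < r n)
    (hF : ∀ n ∈ J, ∀ x ∈ closure U, ‖x - a n‖ ≤ 2 * r n → ‖F (a n) - F x‖ ≤ η)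
    (hs : ∀ x ∈ U, ContDiffAt ℝ ∞ F x) :
    ∃ G : ℂ → ℂ,
      (∀ x, (ContDiffAt ℝ ∞ F x ∨ ∃ n ∈ J, x ∈ ball (a n) (r n)) → ContDiffAt ℝ ∞ G x) ∧
      (∀ x ∈ closure U, ‖G x - F x‖ ≤ η) ∧
      (∀ x ∈ U, ‖dbar G x‖ ≤ ‖dbar F x‖ +
        ∑ n ∈ J, 2 * η * ‖dbar (fun z => stdBump (((r n)⁻¹ : ℝ) * (z - a n))) x‖) ∧
      (∀ x, F x = 0 → (∀ n ∈ J, 2 * r n ≤ ‖x - a n‖) → G x = 0) := by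
  induction J using Finset.induction_on with
  | empty => exact ⟨F, by simp, by simp [hη], by simp, by simp⟩
  | insert k J hk ih =>
    obtain ⟨G, hG1, hG2, hG3, hG4⟩ := ih (fun n hn => hr n (Finset.mem_insert_of_mem hn))
      (fun n hn => hF n (Finset.mem_insert_of_mem hn))
    have hrk := hr k (Finset.mem_insert_self k J)
    have hFk := hF k (Finset.mem_insert_self k J)
    set c := F (a k) with hc
    set ψ : ℂ → ℂ := fun z => stdBump (((r k)⁻¹ : ℝ) * (z - a k)) with hψ
    have hψs : ContDiff ℝ ∞ ψ := contDiff_stdBump_affine _ _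
    have hnorm : ∀ x : ℂ, ‖(((r k)⁻¹ : ℝ) : ℂ) * (x - a k)‖ = (r k)⁻¹ * ‖x - a k‖ := fun x => by
      rw [norm_mul, Complex.norm_real, Real.norm_of_nonneg (by positivity)]
    have hGU : ∀ x ∈ U, ContDiffAt ℝ ∞ G x := fun x hx => hG1 x (Or.inl (hs x hx))
    -- This is (1 - ψ) G + ψ c. It is constant on the new ball, stays within η of `F` by convexity,
    -- and its ∂/∂w̄ gains only (c - G) ∂ψ/∂w̄, where |c - G| ≤ 2η on the support of ψ.
    refine ⟨fun z => G z + ψ z * (c - G z), fun x hx => ?_, fun x hx => ?_, fun x hx => ?_,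
      fun x hx0 hx => ?_⟩
    · by_cases hxk : x ∈ ball (a k) (r k)
      · have : (fun z => G z + ψ z * (c - G z)) =ᶠ[𝓝 x] fun _ => c := by
          filter_upwards [isOpen_ball.mem_nhds hxk] with z hz
          have : ψ z = 1 := by
            refine stdBump_eq_one ?_
            rw [hnorm, inv_mul_le_iff₀ hrk, mul_one]
            exact (mem_ball_iff_norm.1 hz).le
          rw [this]
          ring
        exact contDiffAt_const.congr_of_eventuallyEq this
      · have hGx : ContDiffAt ℝ ∞ G x := by
          refine hG1 x (hx.imp id ?_)
          rintro ⟨n, hn, hxn⟩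
          rcases Finset.mem_insert.1 hn with rfl | hn
          · exact absurd hxn hxk
          · exact ⟨n, hn, hxn⟩
        exact hGx.add (hψs.contDiffAt.mul (contDiffAt_const.sub hGx))
    · have e : G x + ψ x * (c - G x) - F x = (1 - ψ x) * (G x - F x) + ψ x * (c - F x) := by ring
      rw [e]
      refine norm_stdBump_smul_add_le (hG2 x hx) fun h2 => hFk x hx ?_
      rw [hnorm, inv_mul_lt_iff₀ hrk] at h2
      linarith
    · have hGd : DifferentiableAt ℝ G x := (hGU x hx).differentiableAt (by simp)
      have hψd : DifferentiableAt ℝ ψ x := hψs.contDiffAt.differentiableAt (by simp)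
      have hcG : DifferentiableAt ℝ (fun z => c - G z) x := (differentiableAt_const c).sub hGd
      have e : dbar (fun z => G z + ψ z * (c - G z)) x
          = (1 - ψ x) * dbar G x + (c - G x) * dbar ψ x := by
        rw [dbar_fun_add hGd (hψd.fun_mul hcG), dbar_fun_mul hψd hcG,
          dbar_fun_sub (differentiableAt_const c) hGd, dbar_const]
        ring
      have h2 : ‖(c - G x) * dbar ψ x‖ ≤ 2 * η * ‖dbar ψ x‖ := by
        rw [norm_mul]
        rcases le_or_gt ‖x - a k‖ (2 * r k) with h | h
        · refine mul_le_mul_of_nonneg_right ?_ (norm_nonneg _)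
          have h3 := hFk x (subset_closure hx) h
          have h4 := hG2 x (subset_closure hx)
          have h5 := norm_sub_le (c - F x) (G x - F x)
          have h6 : c - F x - (G x - F x) = c - G x := by ring
          rw [h6] at h5
          linarith
        · have : dbar ψ x = 0 := by
            rw [hψ, dbar_comp_affine (contDiff_stdBump.differentiable (by simp)),
              dbar_stdBump_eq_zero_of_gt, mul_zero]
            rw [hnorm, lt_inv_mul_iff₀ hrk]
            linarith
          simp [this]
      rw [Finset.sum_insert hk, e]
      have h3 : ‖(1 - ψ x) * dbar G x‖ ≤ ‖dbar G x‖ := by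
        rw [norm_mul]
        exact mul_le_of_le_one_left (norm_nonneg _) (norm_one_sub_stdBump_le _)
      have h4 := hG3 x hx
      have h5 := norm_add_le ((1 - ψ x) * dbar G x) ((c - G x) * dbar ψ x)
      linarith
    · have h1 : G x = 0 := hG4 x hx0 fun n hn => hx n (Finset.mem_insert_of_mem hn)
      have h2 : ψ x = 0 := by
        refine stdBump_eq_zero ?_
        rw [hnorm, le_inv_mul_iff₀ hrk]
        linarith [hx k (Finset.mem_insert_self k J)]
      simp [h1, h2]

/-- The derivative has size B / r on a disc of area 4πr². The result is linear in r, so finite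
length is the right hypothesis on the boundary. -/
theorem setIntegral_norm_dbar_stdBump_le {B : ℝ} (hB : ∀ z, ‖dbar stdBump z‖ ≤ B) {r : ℝ}
    (hr : 0 < r) (a : ℂ) (U : Set ℂ) :
    Integrable (fun x => ‖dbar (fun z => stdBump ((r⁻¹ : ℝ) * (z - a))) x‖) ∧
    ∫ x in U, ‖dbar (fun z => stdBump ((r⁻¹ : ℝ) * (z - a))) x‖ ≤ 4 * Real.pi * B * r := by
  have hB0 : 0 ≤ B := (norm_nonneg _).trans (hB 0)
  have hle : ∀ x, ‖dbar (fun z => stdBump ((r⁻¹ : ℝ) * (z - a))) x‖ ≤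
      (closedBall a (2 * r)).indicator (fun _ => r⁻¹ * B) x := fun x => by
    rw [dbar_comp_affine (contDiff_stdBump.differentiable (by simp)), norm_mul, Complex.norm_real,
      Real.norm_of_nonneg (by positivity)]
    by_cases hx : x ∈ closedBall a (2 * r)
    · rw [indicator_of_mem hx]
      exact mul_le_mul_of_nonneg_left (hB _) (by positivity)
    · rw [indicator_of_notMem hx, dbar_stdBump_eq_zero_of_gt, norm_zero, mul_zero]
      rw [norm_mul, Complex.norm_real, Real.norm_of_nonneg (by positivity),
        lt_inv_mul_iff₀ hr]
      rw [mem_closedBall_iff_norm, not_le] at hx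
      linarith
  have hind : Integrable ((closedBall a (2 * r)).indicator (fun _ => r⁻¹ * B)) := by
    rw [integrable_indicator_iff measurableSet_closedBall]
    exact integrableOn_const measure_closedBall_lt_top.ne
  have hint : Integrable (fun x => ‖dbar (fun z => stdBump ((r⁻¹ : ℝ) * (z - a))) x‖) := by
    refine hind.mono' (contDiff_stdBump_affine _ _).continuous_dbar.norm.aestronglyMeasurable
      (Eventually.of_forall fun x => ?_)
    rw [norm_norm]
    exact hle x
  refine ⟨hint, ?_⟩
  calc _ ≤ ∫ x, ‖dbar (fun z => stdBump ((r⁻¹ : ℝ) * (z - a))) x‖ :=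
        setIntegral_le_integral hint (Eventually.of_forall fun x => norm_nonneg _)
    _ ≤ ∫ x, (closedBall a (2 * r)).indicator (fun _ => r⁻¹ * B) x :=
        integral_mono hint hind hle
    _ = 4 * Real.pi * B * r := by
        rw [integral_indicator measurableSet_closedBall, setIntegral_const, Measure.real,
          Complex.volume_closedBall, ENNReal.toReal_mul, ENNReal.toReal_pow,
          ENNReal.toReal_ofReal (by positivity), smul_eq_mul]
        simp only [ENNReal.coe_toReal, NNReal.coe_real_pi]
        field_simp
        ring

/-- Green's inequality for functions that are smooth inside and only continuous up to the
boundary. -/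
theorem GreenTangent.norm_integral_le {U : Set ℂ} {T F : ℂ → ℂ} (h : GreenTangent U T)
    (hc : ContinuousOn F (closure U)) (hs : ∀ x ∈ U, ContDiffAt ℝ ∞ F x) {R : ℝ}
    (hR : ∀ x, R ≤ ‖x‖ → F x = 0) (hi : IntegrableOn (fun x => ‖dbar F x‖) U) :
    ‖∫ w in frontier U, F w * T w ∂(Measure.hausdorffMeasure 1 : Measure ℂ)‖ ≤
      2 * ∫ w in U, ‖dbar F w‖ := by
  obtain ⟨B, hB0, hB⟩ := exists_norm_dbar_stdBump_le
  obtain ⟨C, hC0, hC⟩ := exists_finite_ball_cover h.isCompact_frontier h.hausdorffMeasure_lt_top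
  set H := ((Measure.hausdorffMeasure 1 : Measure ℂ) (frontier U)).toReal with hH
  have hH0 : 0 ≤ H := ENNReal.toReal_nonneg
  -- H accounts for replacing `F` by its patched version on the boundary, the other term for the
  -- extra ∂/∂w̄ of the patches inside.
  set M := 2 * (2 * (4 * Real.pi * B * C)) + H with hM
  have hM0 : 0 ≤ M := by positivity
  suffices key : ∀ η > 0, ‖∫ w in frontier U, F w * T w ∂(Measure.hausdorffMeasure 1 : Measure ℂ)‖
      ≤ 2 * (∫ w in U, ‖dbar F w‖) + η * M by
    refine le_of_forall_pos_le_add fun ε hε => (key (ε / (M + 1)) (by positivity)).trans ?_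
    have : ε / (M + 1) * M ≤ ε := by
      rw [div_mul_eq_mul_div, div_le_iff₀ (by positivity)]
      nlinarith
    linarith
  intro η hη
  have hKc : frontier U ⊆ closure U := frontier_subset_closure
  -- `U` may be unbounded, so uniform continuity is taken on a compact neighbourhood of the
  -- boundary; radii below 1 / 2 keep the doubled balls in it.
  have hS : IsCompact (closure U ∩ cthickening 1 (frontier U)) :=
    h.isCompact_frontier.cthickening.inter_left isClosed_closure
  have huc := hS.uniformContinuousOn_of_continuous (hc.mono inter_subset_left)
  obtain ⟨δ, hδ0, hδ⟩ := Metric.uniformContinuousOn_iff.1 huc η hη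
  obtain ⟨J, a, r, hJ, hcov, hsum⟩ := hC (min (δ / 2) (1 / 2)) (by positivity)
  -- Extension by zero is smooth off the boundary on both sides, so patching along the boundary
  -- gives a function smooth on the whole plane.
  set F0 : ℂ → ℂ := (closure U).indicator F with hF0
  have hF0c : ∀ x ∈ closure U, F0 x = F x := fun x hx => indicator_of_mem hx F
  have hF0U : ∀ x ∈ U, F0 =ᶠ[𝓝 x] F := fun x hx => by
    filter_upwards [h.isOpen.mem_nhds hx] with z hz using hF0c z (subset_closure hz)
  obtain ⟨G, hG1, hG2, hG3, hG4⟩ := exists_locally_constant_patch (U := U) (F := F0) hη.le J a r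
    (fun n hn => (hJ n hn).2.1) (fun n hn x hx hxn => by
      obtain ⟨h1, h2, h3⟩ := hJ n hn
      have h4 := h3.trans_le (min_le_left _ _)
      have h5 := h3.trans_le (min_le_right _ _)
      rw [hF0c _ (hKc h1), hF0c _ hx, ← dist_eq_norm]
      refine (hδ _ ⟨hKc h1, self_subset_cthickening _ h1⟩ _ ⟨hx, ?_⟩ ?_).le
      · refine mem_cthickening_of_dist_le x (a n) 1 _ h1 ?_
        rw [dist_eq_norm]
        linarith
      · rw [dist_comm, dist_eq_norm]
        linarith)
    (fun x hx => (hs x hx).congr_of_eventuallyEq (hF0U x hx))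
  have hGs : ContDiff ℝ ∞ G := by
    rw [contDiff_iff_contDiffAt]
    intro x
    refine hG1 x ?_
    by_cases hxc : x ∈ closure U
    · by_cases hxU : x ∈ U
      · exact Or.inl ((hs x hxU).congr_of_eventuallyEq (hF0U x hxU))
      · refine Or.inr ?_
        have : x ∈ frontier U := ⟨hxc, fun hi => hxU (interior_subset hi)⟩
        simpa using hcov this
    · refine Or.inl ?_
      have : F0 =ᶠ[𝓝 x] fun _ => 0 := by
        filter_upwards [isClosed_closure.isOpen_compl.mem_nhds hxc] with z hz
        exact indicator_of_notMem hz F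
      exact contDiffAt_const.congr_of_eventuallyEq this
  have hGc : HasCompactSupport G := by
    obtain ⟨RK, hRK⟩ := h.isCompact_frontier.isBounded.exists_norm_le
    refine HasCompactSupport.intro (isCompact_closedBall 0 (max R (RK + 1))) fun x hx => ?_
    rw [mem_closedBall_zero_iff, not_le, max_lt_iff] at hx
    refine hG4 x ?_ fun n hn => ?_
    · by_cases hxc : x ∈ closure U
      · rw [hF0c x hxc, hR x hx.1.le]
      · exact indicator_of_notMem hxc F
    · obtain ⟨h1, h2, h3⟩ := hJ n hn
      have h5 := h3.trans_le (min_le_right _ _)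
      have := norm_sub_norm_le x (a n)
      linarith [hRK _ h1, hx.2]
  have hgreen := h.green G hGs hGc
  have hbound : ‖∫ w in U, dbar G w‖ ≤ (∫ w in U, ‖dbar F w‖) + 2 * η * (4 * Real.pi * B * C) := by
    have hsumint : IntegrableOn (fun x => ∑ n ∈ J, 2 * η *
        ‖dbar (fun z => stdBump (((r n)⁻¹ : ℝ) * (z - a n))) x‖) U :=
      integrable_finsetSum _ fun n hn =>
        ((setIntegral_norm_dbar_stdBump_le hB (hJ n hn).2.1 (a n) U).1.integrableOn).const_mul _
    calc ‖∫ w in U, dbar G w‖ ≤ ∫ w in U, (‖dbar F w‖ + ∑ n ∈ J, 2 * η *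
        ‖dbar (fun z => stdBump (((r n)⁻¹ : ℝ) * (z - a n))) w‖) := by
          refine norm_integral_le_of_norm_le (hi.add hsumint) ?_
          refine (ae_restrict_iff' h.isOpen.measurableSet).2 (Eventually.of_forall fun w hw => ?_)
          have := hG3 w hw
          rwa [(hF0U w hw).dbar_eq] at this
      _ = (∫ w in U, ‖dbar F w‖) + ∑ n ∈ J, 2 * η *
          ∫ w in U, ‖dbar (fun z => stdBump (((r n)⁻¹ : ℝ) * (z - a n))) w‖ := by
          rw [integral_add hi hsumint, integral_finsetSum]
          · simp only [integral_const_mul]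
          · exact fun n hn =>
              ((setIntegral_norm_dbar_stdBump_le hB (hJ n hn).2.1 (a n) U).1.integrableOn).const_mul _
      _ ≤ (∫ w in U, ‖dbar F w‖) + ∑ n ∈ J, 2 * η * (4 * Real.pi * B * r n) := by
          gcongr with n hn
          exact (setIntegral_norm_dbar_stdBump_le hB (hJ n hn).2.1 (a n) U).2
      _ ≤ _ := by
          rw [← Finset.mul_sum, ← Finset.mul_sum]
          gcongr
  have hdiff : ‖∫ w in frontier U, (F w - G w) * T w ∂(Measure.hausdorffMeasure 1 : Measure ℂ)‖
      ≤ η * H := by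
    refine norm_setIntegral_le_of_norm_le_const h.hausdorffMeasure_lt_top fun w hw => ?_
    have h1 := hG2 w (hKc hw)
    rw [hF0c w (hKc hw), norm_sub_rev] at h1
    rw [norm_mul]
    nlinarith [h.norm_le_one w, norm_nonneg (F w - G w)]
  have hFi := h.integrableOn (hc.mono hKc)
  have hGi := h.integrableOn hGs.continuous.continuousOn
  have hsplit : ∫ w in frontier U, F w * T w ∂(Measure.hausdorffMeasure 1 : Measure ℂ) =
      (∫ w in frontier U, (F w - G w) * T w ∂(Measure.hausdorffMeasure 1 : Measure ℂ)) +
      ∫ w in frontier U, G w * T w ∂(Measure.hausdorffMeasure 1 : Measure ℂ) := by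
    simp only [sub_mul]
    rw [integral_sub hFi hGi, sub_add_cancel]
  rw [hsplit, hgreen]
  refine (norm_add_le _ _).trans ?_
  rw [norm_mul, norm_mul, Complex.norm_I, Complex.norm_ofNat, mul_one]
  rw [hM]
  linarith

theorem ContDiffAt.of_holomorphic {V : Set ℂ} (hV : IsOpen V) {F : ℂ → ℂ}
    (hF : DifferentiableOn ℂ F V) {x : ℂ} (hx : x ∈ V) : ContDiffAt ℝ ∞ F x :=
  ((hF.contDiffOn (n := ∞) hV).contDiffAt (hV.mem_nhds hx)).restrict_scalars ℝ

/-- Smooth cutoff functions to growing annuli about `0`, with scale invariant bounds. -/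
theorem exists_annular_cutoff : ∃ (χ : ℕ → ℂ → ℂ) (B : ℝ), 0 < B ∧ (∀ n, ContDiff ℝ ∞ (χ n)) ∧
    (∀ n : ℕ, ∀ x : ℂ, ‖x‖ ≤ ((n : ℝ) + 1)⁻¹ → χ n x = 0) ∧
    (∀ n : ℕ, ∀ x : ℂ, 2 * ((n : ℝ) + 1) ≤ ‖x‖ → χ n x = 0) ∧
    (∀ n : ℕ, ∀ x : ℂ, ‖x‖ ≤ (n : ℝ) + 1 → 2 * ((n : ℝ) + 1)⁻¹ ≤ ‖x‖ → χ n x = 1) ∧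
    (∀ n x, ‖dbar (χ n) x‖ * ‖x‖ ≤ B) := by
  obtain ⟨B, hB0, hB⟩ := exists_norm_dbar_stdBump_le
  set s : ℝ → ℂ → ℂ := fun t z => stdBump ((t : ℂ) * (z - 0)) with hs
  have hss : ∀ t, ContDiff ℝ ∞ (s t) := fun t => contDiff_stdBump_affine t 0
  have hsd : ∀ t x, DifferentiableAt ℝ (s t) x := fun t x =>
    (hss t).contDiffAt.differentiableAt (by simp)
  have hs1 : ∀ t : ℝ, 0 < t → ∀ x : ℂ, ‖x‖ ≤ t⁻¹ → s t x = 1 := fun t ht x hx => by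
    refine stdBump_eq_one ?_
    rw [sub_zero, norm_mul, Complex.norm_real, Real.norm_of_nonneg ht.le]
    calc t * ‖x‖ ≤ t * t⁻¹ := by gcongr
      _ = 1 := mul_inv_cancel₀ ht.ne'
  have hs0 : ∀ t : ℝ, 0 < t → ∀ x : ℂ, 2 * t⁻¹ ≤ ‖x‖ → s t x = 0 := fun t ht x hx => by
    refine stdBump_eq_zero ?_
    rw [sub_zero, norm_mul, Complex.norm_real, Real.norm_of_nonneg ht.le]
    calc 2 = t * (2 * t⁻¹) := by field_simp
      _ ≤ t * ‖x‖ := by gcongr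
  -- Scale invariance: the left side is |y| |∂b/∂w̄(y)| at y = t x, where b is the standard bump,
  -- and the derivative vanishes for |y| > 2.
  have hdb : ∀ t : ℝ, 0 < t → ∀ x : ℂ, ‖dbar (s t) x‖ * ‖x‖ ≤ 2 * B := fun t ht x => by
    rw [hs, dbar_comp_affine (contDiff_stdBump.differentiable (by simp)), norm_mul,
      Complex.norm_real, Real.norm_of_nonneg ht.le, sub_zero]
    rcases le_or_gt ‖(t : ℂ) * x‖ 2 with h2 | h2
    · have h3 : ‖(t : ℂ) * x‖ = t * ‖x‖ := by
        rw [norm_mul, Complex.norm_real, Real.norm_of_nonneg ht.le]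
      calc t * ‖dbar stdBump (t * x)‖ * ‖x‖ = ‖(t : ℂ) * x‖ * ‖dbar stdBump (t * x)‖ := by
            rw [h3]; ring
        _ ≤ 2 * B := mul_le_mul h2 (hB _) (norm_nonneg _) (by norm_num)
    · rw [dbar_stdBump_eq_zero_of_gt h2]
      simp only [norm_zero, mul_zero, zero_mul]
      positivity
  set χ : ℕ → ℂ → ℂ := fun n z => s ((n : ℝ) + 1)⁻¹ z * (1 - s ((n : ℝ) + 1) z) with hχ
  have hN : ∀ n : ℕ, (0 : ℝ) < (n : ℝ) + 1 := fun n => by positivity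
  have hχs : ∀ n, ContDiff ℝ ∞ (χ n) := fun n => (hss _).mul (contDiff_const.sub (hss _))
  have hχ0 : ∀ n : ℕ, ∀ x : ℂ, ‖x‖ ≤ ((n : ℝ) + 1)⁻¹ → χ n x = 0 := fun n x hx => by
    simp [hχ, hs1 _ (hN n) x hx]
  have hχinf : ∀ n : ℕ, ∀ x : ℂ, 2 * ((n : ℝ) + 1) ≤ ‖x‖ → χ n x = 0 := fun n x hx => by
    have := hs0 ((n : ℝ) + 1)⁻¹ (by positivity) x (by rwa [inv_inv])
    simp [hχ, this]
  have hχ1 : ∀ n : ℕ, ∀ x : ℂ, ‖x‖ ≤ (n : ℝ) + 1 → 2 * ((n : ℝ) + 1)⁻¹ ≤ ‖x‖ → χ n x = 1 :=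
    fun n x hx1 hx2 => by
      have e1 := hs1 ((n : ℝ) + 1)⁻¹ (by positivity) x (by rwa [inv_inv])
      have e2 := hs0 ((n : ℝ) + 1) (hN n) x hx2
      simp [hχ, e1, e2]
  have hχb : ∀ n x, ‖dbar (χ n) x‖ * ‖x‖ ≤ 4 * B := fun n x => by
    have e : dbar (χ n) x = s ((n : ℝ) + 1)⁻¹ x * -dbar (s ((n : ℝ) + 1)) x +
        (1 - s ((n : ℝ) + 1) x) * dbar (s ((n : ℝ) + 1)⁻¹) x := by
      have hd : DifferentiableAt ℝ (fun z => 1 - s ((n : ℝ) + 1) z) x :=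
        (differentiableAt_const _).sub (hsd _ _)
      rw [hχ, dbar_fun_mul (hsd _ _) hd,
        dbar_fun_sub (differentiableAt_const _) (hsd _ _), dbar_const, zero_sub]
    have b1 := hdb _ (hN n) x
    have b2 := hdb ((n : ℝ) + 1)⁻¹ (by positivity) x
    have n1 : ‖s ((n : ℝ) + 1)⁻¹ x * -dbar (s ((n : ℝ) + 1)) x‖ ≤ ‖dbar (s ((n : ℝ) + 1)) x‖ := by
      rw [norm_mul, norm_neg]
      exact mul_le_of_le_one_left (norm_nonneg _) (norm_stdBump_le _)
    have n2 : ‖(1 - s ((n : ℝ) + 1) x) * dbar (s ((n : ℝ) + 1)⁻¹) x‖ ≤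
        ‖dbar (s ((n : ℝ) + 1)⁻¹) x‖ := by
      rw [norm_mul]
      exact mul_le_of_le_one_left (norm_nonneg _) (norm_one_sub_stdBump_le _)
    have n3 : ‖dbar (χ n) x‖ ≤ ‖dbar (s ((n : ℝ) + 1)) x‖ + ‖dbar (s ((n : ℝ) + 1)⁻¹) x‖ := by
      rw [e]
      exact (norm_add_le _ _).trans (add_le_add n1 n2)
    nlinarith [norm_nonneg x]
  exact ⟨χ, 4 * B, by positivity, hχs, hχ0, hχinf, hχ1, hχb⟩

/-- Cauchy's theorem for a function continuous up to the boundary, with the point `0` removed and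
an integrability condition at `0` and at infinity. -/
theorem GreenTangent.integral_eq_zero {U : Set ℂ} {T F : ℂ → ℂ} (h : GreenTangent U T)
    (h0 : (0 : ℂ) ∉ frontier U) (hF : DifferentiableOn ℂ F (U \ {0}))
    (hc : ContinuousOn F (closure U \ {0})) (hi : IntegrableOn (fun w => ‖F w‖ / ‖w‖) U) :
    ∫ w in frontier U, F w * T w ∂(Measure.hausdorffMeasure 1 : Measure ℂ) = 0 := by
  have hV : IsOpen (U \ {0}) := h.isOpen.sdiff isClosed_singleton
  obtain ⟨χ, B, hB0, hχs, hχ0, hχinf, hχ1, hχb⟩ := exists_annular_cutoff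
  have hN : ∀ n : ℕ, (0 : ℝ) < (n : ℝ) + 1 := fun n => by positivity
  have hχd : ∀ n x, DifferentiableAt ℝ (χ n) x := fun n x =>
    (hχs n).contDiffAt.differentiableAt (by simp)
  have hev : ∀ x : ℂ, x ≠ 0 → ∀ᶠ n : ℕ in atTop, ∀ᶠ z in 𝓝 x, χ n z = 1 := fun x hx => by
    have hx' : 0 < ‖x‖ := norm_pos_iff.2 hx
    have t1 : Tendsto (fun n : ℕ => (n : ℝ) + 1) atTop atTop :=
      tendsto_atTop_add_const_right _ _ tendsto_natCast_atTop_atTop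
    have t2 : Tendsto (fun n : ℕ => 2 * ((n : ℝ) + 1)⁻¹) atTop (𝓝 0) := by
      simpa using t1.inv_tendsto_atTop.const_mul 2
    filter_upwards [t1.eventually_gt_atTop ‖x‖, t2.eventually (gt_mem_nhds hx')] with n h1 h2
    filter_upwards [continuous_norm.tendsto x |>.eventually (gt_mem_nhds h1),
      continuous_norm.tendsto x |>.eventually (lt_mem_nhds h2)] with z hz1 hz2
    exact hχ1 n z hz1.le hz2.le
  have hdb0 : ∀ n x, x ∈ U → dbar (fun z => χ n z * F z) x = F x * dbar (χ n) x := fun n x hx => by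
    by_cases hx0 : x = 0
    · have e1 : (fun z => χ n z * F z) =ᶠ[𝓝 x] fun _ => 0 := by
        rw [hx0]
        filter_upwards [ball_mem_nhds (0 : ℂ) (inv_pos.2 (hN n))] with z hz
        rw [hχ0 n z (mem_ball_zero_iff.1 hz).le, zero_mul]
      have e2 : χ n =ᶠ[𝓝 x] fun _ => 0 := by
        rw [hx0]
        filter_upwards [ball_mem_nhds (0 : ℂ) (inv_pos.2 (hN n))] with z hz
        rw [hχ0 n z (mem_ball_zero_iff.1 hz).le]
      rw [e1.dbar_eq, e2.dbar_eq, dbar_const, mul_zero]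
    · have hd := (hF.differentiableAt (hV.mem_nhds ⟨hx, hx0⟩))
      rw [dbar_fun_mul (hχd n x) (hd.restrictScalars ℝ), dbar_eq_zero_of_differentiableAt hd,
        mul_zero, zero_add]
  have hFm : AEStronglyMeasurable F (volume.restrict U) := by
    have h1 : AEStronglyMeasurable F (volume.restrict (U \ {0})) :=
      hF.continuousOn.aestronglyMeasurable hV.measurableSet
    have h2 : volume.restrict (U \ {0}) = volume.restrict U :=
      Measure.restrict_congr_set (sdiff_null_ae_eq_self (by simp))
    rwa [h2] at h1
  have hmeas : ∀ n, AEStronglyMeasurable (fun x => ‖F x * dbar (χ n) x‖) (volume.restrict U) :=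
    fun n => (hFm.mul (hχs n).continuous_dbar.aestronglyMeasurable).norm
  have hdom : ∀ n x, ‖‖F x * dbar (χ n) x‖‖ ≤ B * (‖F x‖ / ‖x‖) := fun n x => by
    rw [norm_norm, norm_mul]
    by_cases hx0 : x = 0
    · have e2 : χ n =ᶠ[𝓝 x] fun _ => 0 := by
        rw [hx0]
        filter_upwards [ball_mem_nhds (0 : ℂ) (inv_pos.2 (hN n))] with z hz
        rw [hχ0 n z (mem_ball_zero_iff.1 hz).le]
      rw [e2.dbar_eq, dbar_const, hx0]
      simp
    · have hx' : 0 < ‖x‖ := norm_pos_iff.2 hx0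
      rw [← mul_div_assoc, le_div_iff₀ hx']
      nlinarith [hχb n x, norm_nonneg (F x)]
  have hint : ∀ n, IntegrableOn (fun x => ‖F x * dbar (χ n) x‖) U := fun n =>
    (hi.const_mul B).mono' (hmeas n) (Eventually.of_forall (hdom n))
  -- The dominating function is the hypothesis `hi` up to the factor B. Pointwise, χₙ is eventually
  -- 1 near each x ≠ 0, so its derivative vanishes there.
  have hlim : Tendsto (fun n => ∫ x in U, ‖F x * dbar (χ n) x‖) atTop (𝓝 0) := by
    have := tendsto_integral_of_dominated_convergence (μ := volume.restrict U)
      (F := fun n x => ‖F x * dbar (χ n) x‖) (f := fun _ => 0) _ hmeas (hi.const_mul B)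
      (fun n => Eventually.of_forall (hdom n)) (by
        have hne : ∀ᵐ x : ℂ ∂(volume.restrict U), x ≠ 0 :=
          ae_restrict_of_ae (by simp [ae_iff])
        filter_upwards [hne] with x hx
        refine tendsto_const_nhds.congr' ?_
        filter_upwards [hev x hx] with n hn
        have : χ n =ᶠ[𝓝 x] fun _ => 1 := hn
        rw [this.dbar_eq, dbar_const]
        simp)
    simpa using this
  have hKn : ∀ᶠ n : ℕ in atTop, ∀ x ∈ frontier U, χ n x = 1 := by
    obtain ⟨R, hR⟩ := h.isCompact_frontier.isBounded.exists_norm_le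
    obtain ⟨ρ, hρ, hρK⟩ := Metric.isOpen_iff.1 isClosed_frontier.isOpen_compl 0 h0
    have t1 : Tendsto (fun n : ℕ => (n : ℝ) + 1) atTop atTop :=
      tendsto_atTop_add_const_right _ _ tendsto_natCast_atTop_atTop
    have t2 : Tendsto (fun n : ℕ => 2 * ((n : ℝ) + 1)⁻¹) atTop (𝓝 0) := by
      simpa using t1.inv_tendsto_atTop.const_mul 2
    filter_upwards [t1.eventually_ge_atTop R, t2.eventually (gt_mem_nhds hρ)] with n h1 h2 x hx
    refine hχ1 n x ((hR x hx).trans h1) (h2.le.trans ?_)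
    by_contra! hlt
    exact hρK (mem_ball_zero_iff.2 hlt) hx
  have hest : ∀ᶠ n : ℕ in atTop,
      ‖∫ w in frontier U, F w * T w ∂(Measure.hausdorffMeasure 1 : Measure ℂ)‖ ≤
        2 * ∫ x in U, ‖F x * dbar (χ n) x‖ := by
    filter_upwards [hKn] with n hn
    have e1 : ∫ w in frontier U, F w * T w ∂(Measure.hausdorffMeasure 1 : Measure ℂ) =
        ∫ w in frontier U, (χ n w * F w) * T w ∂(Measure.hausdorffMeasure 1 : Measure ℂ) :=
      setIntegral_congr_fun isClosed_frontier.measurableSet fun w hw => by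
        simp only [hn w hw, one_mul]
    have e2 : ∀ x ∈ U, ‖dbar (fun z => χ n z * F z) x‖ = ‖F x * dbar (χ n) x‖ := fun x hx => by
      rw [hdb0 n x hx]
    have e3 : ∫ x in U, ‖F x * dbar (χ n) x‖ = ∫ x in U, ‖dbar (fun z => χ n z * F z) x‖ :=
      (setIntegral_congr_fun h.isOpen.measurableSet e2).symm
    rw [e1, e3]
    refine h.norm_integral_le (R := 2 * ((n : ℝ) + 1)) ?_ ?_ ?_ ?_
    · intro x hx
      by_cases hx0 : x = 0
      · refine ContinuousAt.continuousWithinAt ?_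
        have : (fun z => χ n z * F z) =ᶠ[𝓝 x] fun _ => 0 := by
          rw [hx0]
          filter_upwards [ball_mem_nhds (0 : ℂ) (inv_pos.2 (hN n))] with z hz
          rw [hχ0 n z (mem_ball_zero_iff.1 hz).le, zero_mul]
        exact continuousAt_const.congr this.symm
      · have hcx : ContinuousWithinAt F (closure U) x := by
          exact (hc x ⟨hx, hx0⟩).mono_of_mem_nhdsWithin
            (inter_mem_nhdsWithin _ (isOpen_compl_singleton.mem_nhds hx0))
        exact (hχs n).continuous.continuousWithinAt.mul hcx
    · intro x hx
      by_cases hx0 : x = 0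
      · have : (fun z => χ n z * F z) =ᶠ[𝓝 x] fun _ => 0 := by
          rw [hx0]
          filter_upwards [ball_mem_nhds (0 : ℂ) (inv_pos.2 (hN n))] with z hz
          rw [hχ0 n z (mem_ball_zero_iff.1 hz).le, zero_mul]
        exact contDiffAt_const.congr_of_eventuallyEq this
      · exact (hχs n).contDiffAt.mul (ContDiffAt.of_holomorphic hV hF ⟨hx, hx0⟩)
    · intro x hx
      rw [hχinf n x hx, zero_mul]
    · exact (hint n).congr_fun (fun x hx => (e2 x hx).symm) h.isOpen.measurableSet
  have := le_of_tendsto_of_tendsto tendsto_const_nhds (hlim.const_mul 2) hest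
  simpa using this

/-! ### Cauchy kernels -/

theorem integral_dbar_eq_zero {φ : ℂ → ℂ} (hφ : ContDiff ℝ ∞ φ) (hc : HasCompactSupport φ) :
    ∫ w, dbar φ w = 0 := by
  have hd : Differentiable ℝ φ := hφ.differentiable (by simp)
  have hf : Continuous (fderiv ℝ φ) := hφ.continuous_fderiv (by simp)
  have hi : ∀ v : ℂ, Integrable (fun w => fderiv ℝ φ w v) := fun v =>
    (hf.clm_apply continuous_const).integrable_of_hasCompactSupport (hc.fderiv_apply (𝕜 := ℝ) v)
  have key : ∀ v : ℂ, ∫ w, fderiv ℝ φ w v = 0 := fun v => by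
    have := integral_mul_fderiv_eq_neg_fderiv_mul_of_integrable (μ := (volume : Measure ℂ))
      (f := fun _ : ℂ => (1 : ℂ)) (g := φ) (v := v) (by simp) (by simpa using hi v)
      (by simpa using hφ.continuous.integrable_of_hasCompactSupport hc)
      (by fun_prop) fun x _ => hd x
    simpa using this
  unfold dbar
  rw [integral_div, integral_add (hi 1) ((hi Complex.I).const_mul _), integral_const_mul, key, key]
  simp

/-- Green's formula on a bounded set for smooth functions without a condition on the support. -/
theorem green_of_isBounded {K V : Set ℂ} {T : ℂ → ℂ} {μ : Measure ℂ} {σ : ℂ}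
    (hK : MeasurableSet K) (hKb : Bornology.IsBounded K)
    (hV : MeasurableSet V) (hVb : Bornology.IsBounded V)
    (hg : ∀ φ : ℂ → ℂ, ContDiff ℝ ∞ φ → HasCompactSupport φ →
      ∫ w in K, φ w * T w ∂μ = σ * ∫ w in V, dbar φ w)
    {φ : ℂ → ℂ} (hφ : ContDiff ℝ ∞ φ) :
    ∫ w in K, φ w * T w ∂μ = σ * ∫ w in V, dbar φ w := by
  obtain ⟨R, hR0, hR⟩ := (hKb.union hVb).exists_pos_norm_lt
  set s : ℂ → ℂ := fun z => stdBump ((R⁻¹ : ℝ) * (z - 0)) with hs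
  have hn : ∀ z : ℂ, ‖((R⁻¹ : ℝ) : ℂ) * (z - 0)‖ = R⁻¹ * ‖z‖ := fun z => by
    rw [sub_zero, norm_mul, Complex.norm_real, Real.norm_of_nonneg (by positivity)]
  have hs1 : ∀ z, ‖z‖ < R → s z = 1 := fun z hz => by
    refine stdBump_eq_one ?_
    rw [hn, inv_mul_le_iff₀ hR0]
    linarith
  have hss : ContDiff ℝ ∞ s := contDiff_stdBump_affine _ _
  have hsc : HasCompactSupport s := by
    refine HasCompactSupport.intro (isCompact_closedBall 0 (2 * R)) fun z hz => ?_
    rw [mem_closedBall_zero_iff, not_le] at hz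
    refine stdBump_eq_zero ?_
    rw [hn, le_inv_mul_iff₀ hR0]
    linarith
  have h1 := hg (fun z => s z * φ z) (hss.mul hφ) (hsc.mul_right)
  have e1 : ∫ w in K, s w * φ w * T w ∂μ = ∫ w in K, φ w * T w ∂μ :=
    setIntegral_congr_fun hK fun w hw => by simp only [hs1 w (hR w (Or.inl hw)), one_mul]
  have e2 : ∫ w in V, dbar (fun z => s z * φ z) w = ∫ w in V, dbar φ w :=
    setIntegral_congr_fun hV fun w hw => by
      refine EventuallyEq.dbar_eq ?_
      filter_upwards [continuous_norm.tendsto w |>.eventually (gt_mem_nhds (hR w (Or.inr hw)))]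
        with z hz
      rw [hs1 z hz, one_mul]
  rw [e1, e2] at h1
  exact h1

/-- A smooth regularization of the Cauchy kernel `1 / (w - p)`. -/
noncomputable def smoothKernel (p : ℂ) (ε : ℝ) (w : ℂ) : ℂ :=
  (starRingEnd ℂ) (w - p) / ((‖w - p‖ ^ 2 + ε ^ 2 : ℝ) : ℂ)

theorem contDiff_smoothKernel (p : ℂ) {ε : ℝ} (hε : 0 < ε) : ContDiff ℝ ∞ (smoothKernel p ε) := by
  have h1 : ContDiff ℝ ∞ (fun w : ℂ => (starRingEnd ℂ) (w - p)) :=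
    Complex.conjCLE.contDiff.comp (contDiff_id.sub contDiff_const)
  have h2 : ContDiff ℝ ∞ (fun w : ℂ => ((‖w - p‖ ^ 2 + ε ^ 2 : ℝ) : ℂ)) :=
    Complex.ofRealCLM.contDiff.comp
      (((contDiff_id.sub contDiff_const).norm_sq ℝ).add contDiff_const)
  have h3 : smoothKernel p ε = fun w => (starRingEnd ℂ) (w - p) *
      ((‖w - p‖ ^ 2 + ε ^ 2 : ℝ) : ℂ)⁻¹ := by
    funext w
    rw [smoothKernel, div_eq_mul_inv]
  rw [h3]
  refine h1.mul (h2.inv fun w => ?_)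
  rw [Complex.ofReal_ne_zero]
  positivity

/-- With c the conjugate of w - p and D = |w - p|² + ε², differentiating c = K D gives 1 = K (w - p)
+ D ∂K/∂w̄, and D - (w - p) c = ε². The outcome is a positive approximate point mass at p. -/
theorem dbar_smoothKernel (p : ℂ) {ε : ℝ} (hε : 0 < ε) (w : ℂ) :
    dbar (smoothKernel p ε) w = ((ε ^ 2 / (‖w - p‖ ^ 2 + ε ^ 2) ^ 2 : ℝ) : ℂ) := by
  set c : ℂ → ℂ := fun w => (starRingEnd ℂ) (w - p) with hc
  set D : ℂ → ℂ := fun w => (w - p) * c w + (ε ^ 2 : ℝ) with hD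
  have hDr : ∀ w, D w = ((‖w - p‖ ^ 2 + ε ^ 2 : ℝ) : ℂ) := fun w => by
    simp only [hD, hc, Complex.mul_conj, Complex.normSq_eq_norm_sq]
    push_cast
    ring
  have hD0 : ∀ w, D w ≠ 0 := fun w => by
    rw [hDr, Complex.ofReal_ne_zero]
    positivity
  have hcd : HasFDerivAt c (Complex.conjCLE : ℂ →L[ℝ] ℂ) w :=
    Complex.conjCLE.hasFDerivAt.comp w ((hasFDerivAt_id (𝕜 := ℝ) w).sub_const p)
  have hc1 : dbar c w = 1 := by
    simp [dbar, hcd.fderiv]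
  have hid : DifferentiableAt ℂ (fun z : ℂ => z - p) w := by fun_prop
  have hDd : DifferentiableAt ℝ D w :=
    ((hid.restrictScalars ℝ).mul hcd.differentiableAt).add (differentiableAt_const _)
  have hD1 : dbar D w = w - p := by
    rw [hD, dbar_fun_add ((hid.restrictScalars ℝ).fun_mul hcd.differentiableAt)
      (differentiableAt_const _), dbar_fun_mul (hid.restrictScalars ℝ) hcd.differentiableAt,
      dbar_eq_zero_of_differentiableAt hid, dbar_const, hc1]
    ring
  have hKd : DifferentiableAt ℝ (smoothKernel p ε) w :=
    (contDiff_smoothKernel p hε).contDiffAt.differentiableAt (by simp)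
  have hKD : ∀ z, smoothKernel p ε z = c z / D z := fun z => by rw [hDr]; rfl
  have hprod : c = fun z => smoothKernel p ε z * D z := by
    funext z
    rw [hKD, div_mul_cancel₀ _ (hD0 z)]
  have hmul := dbar_fun_mul hKd hDd
  rw [← hprod, hc1, hD1, hKD] at hmul
  have h3 : dbar (smoothKernel p ε) w = (ε ^ 2 : ℝ) / (D w) ^ 2 := by
    have h4 : D w = (w - p) * c w + (ε ^ 2 : ℝ) := rfl
    rw [eq_div_iff (pow_ne_zero 2 (hD0 w))]
    have h5 : D w = c w * (w - p) + D w * D w * dbar (smoothKernel p ε) w := by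
      have := congrArg (fun t => D w * t) hmul
      field_simp [hD0 w] at this
      linear_combination this
    linear_combination h4 - h5
  rw [h3, hDr]
  push_cast
  ring

theorem norm_smoothKernel_le (p : ℂ) (ε : ℝ) (w : ℂ) : ‖smoothKernel p ε w‖ ≤ ‖w - p‖⁻¹ := by
  rcases eq_or_ne w p with rfl | hw
  · simp [smoothKernel]
  have hw' : 0 < ‖w - p‖ := norm_pos_iff.2 (sub_ne_zero.2 hw)
  rw [smoothKernel, norm_div, Complex.norm_real, Real.norm_of_nonneg (by positivity),
    RCLike.norm_conj, div_le_iff₀ (by positivity), inv_mul_eq_div, le_div_iff₀ hw']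
  nlinarith

theorem tendsto_smoothKernel {p w : ℂ} (hw : w ≠ p) :
    Tendsto (fun n : ℕ => smoothKernel p (1 / ((n : ℝ) + 1)) w) atTop (𝓝 (w - p)⁻¹) := by
  have h1 : Tendsto (fun n : ℕ => ((‖w - p‖ ^ 2 + (1 / ((n : ℝ) + 1)) ^ 2 : ℝ) : ℂ)) atTop
      (𝓝 ((‖w - p‖ ^ 2 + 0 ^ 2 : ℝ) : ℂ)) :=
    (Complex.continuous_ofReal.tendsto _).comp
      ((tendsto_one_div_add_atTop_nhds_zero_nat.pow 2).const_add _)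
  have h2 : (w - p)⁻¹ = (starRingEnd ℂ) (w - p) / ((‖w - p‖ ^ 2 + 0 ^ 2 : ℝ) : ℂ) := by
    rw [Complex.inv_def, Complex.normSq_eq_norm_sq]
    simp [div_eq_mul_inv]
  rw [h2]
  refine Tendsto.div tendsto_const_nhds h1 ?_
  rw [Complex.ofReal_ne_zero]
  have : 0 < ‖w - p‖ := norm_pos_iff.2 (sub_ne_zero.2 hw)
  positivity

section Kernel

variable {K V : Set ℂ} {T : ℂ → ℂ} {μ : Measure ℂ} {σ p : ℂ}

/-- Green's formula for the smoothed kernel, whose boundary side converges dominated by |w - p|⁻¹ as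
p is off K. The factor σ is left free so that V can be either the domain (σ = 2i) or its complement
(σ = -2i), whichever is bounded. -/
theorem tendsto_setIntegral_poisson (hK : IsCompact K) (hKμ : μ K < ⊤) (hT : Measurable T)
    (hT1 : ∀ w, ‖T w‖ ≤ 1) (hV : MeasurableSet V) (hVb : Bornology.IsBounded V)
    (hg : ∀ φ : ℂ → ℂ, ContDiff ℝ ∞ φ → HasCompactSupport φ →
      ∫ w in K, φ w * T w ∂μ = σ * ∫ w in V, dbar φ w) (hp : p ∉ K) :
    Tendsto (fun n : ℕ => σ * ((∫ w in V, (1 / ((n : ℝ) + 1)) ^ 2 /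
      (‖w - p‖ ^ 2 + (1 / ((n : ℝ) + 1)) ^ 2) ^ 2 : ℝ) : ℂ)) atTop
      (𝓝 (∫ w in K, (w - p)⁻¹ * T w ∂μ)) := by
  have hε : ∀ n : ℕ, 0 < 1 / ((n : ℝ) + 1) := fun n => by positivity
  have hne : ∀ w ∈ K, w ≠ p := fun w hw h => hp (h ▸ hw)
  have e : ∀ n : ℕ, σ * ((∫ w in V, (1 / ((n : ℝ) + 1)) ^ 2 /
      (‖w - p‖ ^ 2 + (1 / ((n : ℝ) + 1)) ^ 2) ^ 2 : ℝ) : ℂ) =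
      ∫ w in K, smoothKernel p (1 / ((n : ℝ) + 1)) w * T w ∂μ := fun n => by
    rw [green_of_isBounded hK.measurableSet hK.isBounded hV hVb hg (contDiff_smoothKernel p (hε n))]
    simp only [dbar_smoothKernel p (hε n)]
    rw [integral_complex_ofReal]
  simp only [e]
  have hcont : ContinuousOn (fun w : ℂ => (w - p)⁻¹) K :=
    ContinuousOn.inv₀ (by fun_prop) fun w hw => sub_ne_zero.2 (hne w hw)
  have hint : IntegrableOn (fun w => ‖(w - p)⁻¹‖) K μ := by
    have := (integrableOn_mul_of_isCompact (T := fun _ => 1) hK hKμ hcont measurable_const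
      (by simp)).norm
    simpa [IntegrableOn] using this
  refine tendsto_integral_of_dominated_convergence (fun w => ‖(w - p)⁻¹‖) (fun n => ?_) hint
    (fun n => ?_) ?_
  · exact (contDiff_smoothKernel p (hε n)).continuous.aestronglyMeasurable.mul
      hT.aestronglyMeasurable
  · refine Eventually.of_forall fun w => ?_
    rw [norm_mul, norm_inv]
    exact (mul_le_of_le_one_right (norm_nonneg _) (hT1 w)).trans (norm_smoothKernel_le p _ w)
  · refine (ae_restrict_iff' hK.measurableSet).2 (Eventually.of_forall fun w hw => ?_)
    exact (tendsto_smoothKernel (hne w hw)).mul_const _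

theorem integrableOn_poisson (hVb : Bornology.IsBounded V) {ε : ℝ} (hε : 0 < ε) :
    IntegrableOn (fun w : ℂ => ε ^ 2 / (‖w - p‖ ^ 2 + ε ^ 2) ^ 2) V := by
  obtain ⟨R, hR⟩ := hVb.subset_closedBall 0
  have hc : Continuous (fun w : ℂ => ε ^ 2 / (‖w - p‖ ^ 2 + ε ^ 2) ^ 2) := by
    refine Continuous.div (by fun_prop) (by fun_prop) fun w => ?_
    positivity
  exact (hc.continuousOn.integrableOn_compact (isCompact_closedBall 0 R)).mono_set hR

theorem setIntegral_inv_sub_ne_zero (hK : IsCompact K) (hKμ : μ K < ⊤) (hT : Measurable T)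
    (hT1 : ∀ w, ‖T w‖ ≤ 1) (hV : MeasurableSet V) (hVb : Bornology.IsBounded V) (hσ : σ ≠ 0)
    (hg : ∀ φ : ℂ → ℂ, ContDiff ℝ ∞ φ → HasCompactSupport φ →
      ∫ w in K, φ w * T w ∂μ = σ * ∫ w in V, dbar φ w) (hp : p ∉ K) (hpV : p ∈ interior V) :
    ∫ w in K, (w - p)⁻¹ * T w ∂μ ≠ 0 := by
  have ht := (tendsto_setIntegral_poisson hK hKμ hT hT1 hV hVb hg hp).norm
  obtain ⟨ρ, hρ, hρV⟩ := Metric.isOpen_iff.1 isOpen_interior p hpV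
  have hlow : ∀ᶠ n : ℕ in atTop, ‖σ‖ * (Real.pi / 4) ≤
      ‖σ * ((∫ w in V, (1 / ((n : ℝ) + 1)) ^ 2 /
      (‖w - p‖ ^ 2 + (1 / ((n : ℝ) + 1)) ^ 2) ^ 2 : ℝ) : ℂ)‖ := by
    filter_upwards [tendsto_one_div_add_atTop_nhds_zero_nat (𝕜 := ℝ) |>.eventually
      (gt_mem_nhds hρ)] with n hn
    have hε : 0 < 1 / ((n : ℝ) + 1) := by positivity
    set ε := 1 / ((n : ℝ) + 1) with hεd
    have hb : ball p ε ⊆ V := (ball_subset_ball hn.le).trans (hρV.trans interior_subset)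
    -- Only a lower bound is needed: on the disc of radius ε the integrand is at least 1 / (4ε²),
    -- and the disc has area πε².
    have hle : Real.pi / 4 ≤ ∫ w in V, ε ^ 2 / (‖w - p‖ ^ 2 + ε ^ 2) ^ 2 :=
      calc Real.pi / 4 = ∫ w in ball p ε, 1 / (4 * ε ^ 2) := by
            rw [setIntegral_const, Measure.real, Complex.volume_ball, ENNReal.toReal_mul,
              ENNReal.toReal_pow, ENNReal.toReal_ofReal hε.le, smul_eq_mul]
            simp only [ENNReal.coe_toReal, NNReal.coe_real_pi]
            field_simp
        _ ≤ ∫ w in ball p ε, ε ^ 2 / (‖w - p‖ ^ 2 + ε ^ 2) ^ 2 := by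
            refine setIntegral_mono_on (integrableOn_const measure_ball_lt_top.ne)
              (integrableOn_poisson isBounded_ball hε) measurableSet_ball fun w hw => ?_
            have h1 := mem_ball_iff_norm.1 hw
            have h2 : ‖w - p‖ ^ 2 ≤ ε ^ 2 := by
              gcongr
            rw [div_le_div_iff₀ (by positivity) (by positivity)]
            have h3 : (‖w - p‖ ^ 2 + ε ^ 2) ^ 2 ≤ (ε ^ 2 + ε ^ 2) ^ 2 := by gcongr
            nlinarith
        _ ≤ ∫ w in V, ε ^ 2 / (‖w - p‖ ^ 2 + ε ^ 2) ^ 2 :=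
            setIntegral_mono_set (integrableOn_poisson hVb hε)
              (Eventually.of_forall fun w => by positivity) hb.eventuallyLE
    rw [norm_mul, Complex.norm_real]
    exact mul_le_mul_of_nonneg_left (hle.trans (le_abs_self _)) (norm_nonneg _)
  have := ge_of_tendsto ht hlow
  have hpos : 0 < ‖σ‖ * (Real.pi / 4) := by positivity
  exact norm_pos_iff.1 (hpos.trans_le this)

/-- At distance ρ > 0 from V the bump is at most ε² / ρ⁴, so its integral over the bounded set V
tends to 0. -/
theorem setIntegral_inv_sub_eq_zero (hK : IsCompact K) (hKμ : μ K < ⊤) (hT : Measurable T)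
    (hT1 : ∀ w, ‖T w‖ ≤ 1) (hV : MeasurableSet V) (hVb : Bornology.IsBounded V)
    (hg : ∀ φ : ℂ → ℂ, ContDiff ℝ ∞ φ → HasCompactSupport φ →
      ∫ w in K, φ w * T w ∂μ = σ * ∫ w in V, dbar φ w) (hp : p ∉ K) (hpV : p ∉ closure V) :
    ∫ w in K, (w - p)⁻¹ * T w ∂μ = 0 := by
  have ht := tendsto_setIntegral_poisson hK hKμ hT hT1 hV hVb hg hp
  obtain ⟨ρ, hρ, hρV⟩ := Metric.isOpen_iff.1 isClosed_closure.isOpen_compl p hpV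
  have hI : Tendsto (fun n : ℕ => ∫ w in V, (1 / ((n : ℝ) + 1)) ^ 2 /
      (‖w - p‖ ^ 2 + (1 / ((n : ℝ) + 1)) ^ 2) ^ 2) atTop (𝓝 0) := by
    have hup : Tendsto (fun n : ℕ => (1 / ((n : ℝ) + 1)) ^ 2 / ρ ^ 4 * volume.real V) atTop
        (𝓝 0) := by
      have := ((tendsto_one_div_add_atTop_nhds_zero_nat (𝕜 := ℝ)).pow 2).div_const (ρ ^ 4)
        |>.mul_const (volume.real V)
      simpa using this
    refine squeeze_zero (fun n => integral_nonneg fun w => by positivity) (fun n => ?_) hup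
    have hε : 0 < 1 / ((n : ℝ) + 1) := by positivity
    set ε := 1 / ((n : ℝ) + 1) with hεd
    calc _ ≤ ∫ w in V, ε ^ 2 / ρ ^ 4 := by
          refine setIntegral_mono_on (integrableOn_poisson hVb hε)
            (integrableOn_const hVb.measure_lt_top.ne) hV fun w hw => ?_
          have h1 : ρ ≤ ‖w - p‖ := by
            by_contra! hlt
            exact hρV (mem_ball_iff_norm.2 hlt) (subset_closure hw)
          refine div_le_div_of_nonneg_left (by positivity) (by positivity) ?_
          calc ρ ^ 4 = (ρ ^ 2 + 0) ^ 2 := by ring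
            _ ≤ (‖w - p‖ ^ 2 + ε ^ 2) ^ 2 := by gcongr; positivity
      _ = _ := by rw [setIntegral_const, smul_eq_mul, mul_comm]
  have h2 := ((Complex.continuous_ofReal.tendsto _).comp hI).const_mul σ
  have := tendsto_nhds_unique ht h2
  simpa using this

end Kernel

namespace GreenTangent

variable {U : Set ℂ} {T : ℂ → ℂ} {p z : ℂ}

/-- The integral of ∂φ/∂w̄ over the whole plane vanishes, so the two sides of the boundary carry
opposite integrals. This makes the bounded case available when `U` contains a neighbourhood of ∞. -/
theorem green_compl (h : GreenTangent U T) (φ : ℂ → ℂ) (hφ : ContDiff ℝ ∞ φ)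
    (hc : HasCompactSupport φ) :
    ∫ w in frontier U, φ w * T w ∂(Measure.hausdorffMeasure 1 : Measure ℂ) =
      -(2 * Complex.I) * ∫ w in Uᶜ, dbar φ w := by
  have hi : Integrable (dbar φ) :=
    hφ.continuous_dbar.integrable_of_hasCompactSupport hc.dbar
  have h1 := integral_add_compl h.isOpen.measurableSet hi
  rw [integral_dbar_eq_zero hφ hc] at h1
  rw [h.green φ hφ hc]
  linear_combination 2 * Complex.I * h1

theorem integral_inv_sub_ne_zero_of_isBounded_compl (h : GreenTangent U T)
    (hU : Bornology.IsBounded Uᶜ) (hz : z ∉ closure U) :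
    ∫ w in frontier U, (w - z)⁻¹ * T w ∂(Measure.hausdorffMeasure 1 : Measure ℂ) ≠ 0 :=
  setIntegral_inv_sub_ne_zero h.isCompact_frontier h.hausdorffMeasure_lt_top h.measurable
    h.norm_le_one h.isOpen.measurableSet.compl hU (by simp) h.green_compl
    (fun hf => hz (frontier_subset_closure hf)) (by rwa [interior_compl])

/-- The integrand has its only pole in `U` at p and a double zero at ∞, so bounded and unbounded `U`
can be treated alike. In the first case the p-term alone survives, in the second the z-term. -/
theorem integral_inv_sub_sub_inv_sub_ne_zero (h : GreenTangent U T)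
    (hU : Bornology.IsBounded U ∨ Bornology.IsBounded Uᶜ) (hp : p ∈ U) (hz : z ∉ closure U) :
    ∫ w in frontier U, ((w - p)⁻¹ - (w - z)⁻¹) * T w
      ∂(Measure.hausdorffMeasure 1 : Measure ℂ) ≠ 0 := by
  have hzf : z ∉ frontier U := fun hf => hz (frontier_subset_closure hf)
  have hpf : p ∉ frontier U := fun hf => (h.isOpen.frontier_eq ▸ hf).2 hp
  have hc : ∀ q, q ∉ frontier U → ContinuousOn (fun w => (w - q)⁻¹) (frontier U) := fun q hq =>
    ContinuousOn.inv₀ (by fun_prop) fun w hw => sub_ne_zero.2 fun e => hq (e ▸ hw)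
  simp only [sub_mul]
  rw [integral_sub (h.integrableOn (hc p hpf)) (h.integrableOn (hc z hzf))]
  rcases hU with hU | hU
  · rw [setIntegral_inv_sub_eq_zero h.isCompact_frontier h.hausdorffMeasure_lt_top h.measurable
      h.norm_le_one h.isOpen.measurableSet hU h.green hzf hz, sub_zero]
    exact setIntegral_inv_sub_ne_zero h.isCompact_frontier h.hausdorffMeasure_lt_top h.measurable
      h.norm_le_one h.isOpen.measurableSet hU (by simp) h.green hpf (by rwa [h.isOpen.interior_eq])
  · rw [setIntegral_inv_sub_eq_zero h.isCompact_frontier h.hausdorffMeasure_lt_top h.measurable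
      h.norm_le_one h.isOpen.measurableSet.compl hU h.green_compl hpf
      (by rw [closure_compl, h.isOpen.interior_eq]; simpa using hp), zero_sub, neg_ne_zero]
    exact h.integral_inv_sub_ne_zero_of_isBounded_compl hU hz

end GreenTangent

/-! ### Domains of the sphere and their planar parts -/

theorem planePart_frontier (Ω : Set RSphere) : planePart (frontier Ω) = frontier (planePart Ω) :=
  OnePoint.isOpenEmbedding_coe.isOpenMap.preimage_frontier_eq_frontier_preimage
    OnePoint.continuous_coe Ω

theorem planePart_closure (Ω : Set RSphere) : planePart (closure Ω) = closure (planePart Ω) :=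
  OnePoint.isOpenEmbedding_coe.isOpenMap.preimage_closure_eq_closure_preimage
    OnePoint.continuous_coe Ω

theorem isOpen_planePart {Ω : Set RSphere} (hΩ : IsOpen Ω) : IsOpen (planePart Ω) :=
  hΩ.preimage OnePoint.continuous_coe

theorem isCompact_planePart {S : Set RSphere} (hS : IsClosed S) (h : OnePoint.infty ∉ S) :
    IsCompact (planePart S) := by
  have := ((OnePoint.isOpen_iff_of_mem (s := Sᶜ) h).1 hS.isOpen_compl).2
  rwa [preimage_compl, compl_compl] at this

namespace IsLQD

variable {Ω : Set RSphere} {h : RatFunc ℂ} {T T' : ℂ → ℂ}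

theorem greenTangent (hΩ : IsLQD Ω h) (hT : IsPositiveTangent Ω T) :
    GreenTangent (planePart Ω) T where
  isOpen := isOpen_planePart hΩ.isOpen
  isCompact_frontier := by
    rw [← planePart_frontier]
    exact isCompact_planePart isClosed_frontier hΩ.infty_notMem
  hausdorffMeasure_lt_top := by
    rw [← planePart_frontier]
    exact hΩ.rectifiable
  measurable := hT.measurable
  norm_le_one := hT.norm_le_one
  green := by
    rw [← planePart_frontier]
    exact hT.green

theorem isBounded_or (hΩ : IsLQD Ω h) :
    Bornology.IsBounded (planePart Ω) ∨ Bornology.IsBounded (planePart Ω)ᶜ := by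
  by_cases hi : OnePoint.infty ∈ Ω
  · exact Or.inr (isCompact_planePart hΩ.isOpen.isClosed_compl (by simpa using hi)).isBounded
  · refine Or.inl ((isCompact_planePart isClosed_closure ?_).isBounded.subset fun w hw =>
      subset_closure (s := Ω) hw)
    intro hc
    exact hΩ.infty_notMem ⟨hc, fun h' => hi (interior_subset h')⟩

theorem isBounded_compl (hΩ : IsLQD Ω h) (hi : OnePoint.infty ∈ Ω) :
    Bornology.IsBounded (planePart Ω)ᶜ :=
  (isCompact_planePart hΩ.isOpen.isClosed_compl (by simpa using hi)).isBounded

/-- If the closure contained every finite point, Ω would be dense in the sphere, and Ω = Int Cl Ω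
would be everything. -/
theorem exists_notMem_closure (hΩ : IsLQD Ω h) (hne : Ω ≠ univ) :
    ∃ z : ℂ, z ∉ closure (planePart Ω) := by
  by_contra! hall
  refine hne ?_
  have hd : (univ : Set RSphere) ⊆ closure Ω := by
    rw [← OnePoint.denseRange_coe.closure_range]
    refine closure_minimal ?_ isClosed_closure
    rintro _ ⟨w, rfl⟩
    have := hall w
    rwa [← planePart_closure] at this
  rw [← hΩ.interior_closure, univ_subset_iff.1 hd, interior_univ]

/-- The positive tangent is unique up to sets of length zero. -/
theorem tangent_ae_eq (hΩ : IsLQD Ω h) (hT : IsPositiveTangent Ω T)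
    (hT' : IsPositiveTangent Ω T') :
    T =ᵐ[(Measure.hausdorffMeasure 1 : Measure ℂ).restrict (planePart (frontier Ω))] T' := by
  set μ := (Measure.hausdorffMeasure 1 : Measure ℂ).restrict (planePart (frontier Ω)) with hμ
  have : IsFiniteMeasure μ := ⟨by rw [hμ, Measure.restrict_apply_univ]; exact hΩ.rectifiable⟩
  have hi : ∀ S, IsPositiveTangent Ω S → Integrable S μ := fun S hS =>
    Integrable.of_bound hS.measurable.aestronglyMeasurable 1 (Eventually.of_forall hS.norm_le_one)
  have hmul : ∀ S, IsPositiveTangent Ω S → ∀ g : ℂ → ℝ, Continuous g → HasCompactSupport g →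
      Integrable (fun x => g x • S x) μ := fun S hS g hg hgc => by
    obtain ⟨C, hC⟩ := hgc.exists_bound_of_continuous hg
    exact (hi S hS).bdd_smul C hg.aestronglyMeasurable (Eventually.of_forall hC)
  -- The right side of Green's formula does not involve the tangent, so `T` and `T'` agree against
  -- all smooth compactly supported functions.
  have h0 := ae_eq_zero_of_integral_contDiff_smul_eq_zero (f := fun x => T x - T' x) (μ := μ)
    ((hi T hT).sub (hi T' hT')).locallyIntegrable (fun g hg hgc => by
      have hgs : ContDiff ℝ ∞ (fun w => (g w : ℂ)) := Complex.ofRealCLM.contDiff.comp hg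
      have hgcs : HasCompactSupport (fun w => (g w : ℂ)) :=
        hgc.comp_left (g := fun t : ℝ => (t : ℂ)) (by simp)
      have e := (hT.green _ hgs hgcs).trans (hT'.green _ hgs hgcs).symm
      simp only [smul_sub]
      rw [integral_sub (hmul T hT g hg.continuous hgc) (hmul T' hT' g hg.continuous hgc)]
      simp only [Complex.real_smul]
      exact sub_eq_zero.2 e)
  filter_upwards [h0] with x hx using sub_eq_zero.1 hx

end IsLQD

theorem MemA.differentiableOn {Ω : Set RSphere} {f : RSphere → ℂ} (hf : MemA Ω f) :
    DifferentiableOn ℂ (fun w : ℂ => f w) (planePart Ω) :=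
  fun w hw => (hf.1.1 w hw).differentiableWithinAt

theorem MemA.continuousOn {Ω : Set RSphere} {f : RSphere → ℂ} (hf : MemA Ω f) :
    ContinuousOn (fun w : ℂ => f w) (closure (planePart Ω)) := by
  rw [← planePart_closure]
  exact hf.2.comp OnePoint.continuous_coe.continuousOn fun w hw => hw

theorem zero_notMem_frontier {Ω : Set RSphere} (hΩ : IsOpen Ω) (h0 : ((0 : ℂ) : RSphere) ∈ Ω) :
    (0 : ℂ) ∉ frontier (planePart Ω) := fun hf =>
  ((isOpen_planePart hΩ).frontier_eq ▸ hf).2 h0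

/-- A point charge at the origin does not contribute to the quadrature identity. -/
theorem MemLa1.integral_div_eq_zero {Ω : Set RSphere} {f : RSphere → ℂ} {T : ℂ → ℂ}
    (hT : GreenTangent (planePart Ω) T) (h0 : (0 : ℂ) ∉ frontier (planePart Ω))
    (hf : MemLa1 Ω f) :
    ∫ w in frontier (planePart Ω), f (w : RSphere) / w * T w
      ∂(Measure.hausdorffMeasure 1 : Measure ℂ) = 0 := by
  refine hT.integral_eq_zero h0 ?_ ?_ ?_
  · exact (hf.1.differentiableOn.mono sdiff_subset).div differentiableOn_id fun w hw => hw.2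
  · exact (hf.1.continuousOn.mono sdiff_subset).div continuousOn_id fun w hw => hw.2
  -- For F = f / w the condition ∫ |F| / |w| < ∞ is exactly integrability of f against |w|⁻².
  · have hi : IntegrableOn (fun w : ℂ => ‖f w / ((‖w‖ ^ 2 : ℝ) : ℂ)‖) (planePart Ω) := hf.2.norm
    refine hi.congr_fun (fun w _ => ?_) hT.isOpen.measurableSet
    simp only [norm_div, Complex.norm_real, norm_pow, norm_norm]
    rw [div_div, sq]

/-! ### Rational test functions with a single pole -/

/-- The function `1 / (w - z)` on the sphere, with value `0` at infinity. -/
noncomputable def invSub (z : ℂ) (x : RSphere) : ℂ := x.elim 0 (fun w : ℂ => (w - z)⁻¹)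

@[simp]
theorem invSub_coe (z w : ℂ) : invSub z (w : RSphere) = (w - z)⁻¹ := rfl

@[simp]
theorem invSub_infty (z : ℂ) : invSub z OnePoint.infty = 0 := rfl

theorem invSub_chartAtInfinity (z ζ : ℂ) : invSub z (chartAtInfinity ζ) = ζ / (1 - z * ζ) := by
  by_cases h : ζ = 0
  · simp [chartAtInfinity, h]
  · rw [chartAtInfinity, if_neg h, invSub_coe]
    have : ζ⁻¹ - z = (1 - z * ζ) / ζ := by field_simp
    rw [this, inv_div]

theorem continuousAt_invSub {z : ℂ} {x : RSphere} (hx : x ≠ z) : ContinuousAt (invSub z) x := by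
  induction x using OnePoint.rec with
  | infty =>
    rw [OnePoint.continuousAt_infty', coclosedCompact_eq_cocompact, ← cobounded_eq_cocompact]
    have h1 : Tendsto (fun w : ℂ => w - z) (Bornology.cobounded ℂ) (Bornology.cobounded ℂ) :=
      tendsto_sub_const_cobounded z
    exact tendsto_inv₀_cobounded.comp h1
  | coe w =>
    rw [OnePoint.continuousAt_coe]
    have hw : w - z ≠ 0 := sub_ne_zero.2 fun e => hx (by rw [e])
    exact (continuousAt_id.sub continuousAt_const).inv₀ hw

theorem memA_eval_invSub {Ω : Set RSphere} {z : ℂ} (hz : z ∉ closure (planePart Ω))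
    (S : Polynomial ℂ) : MemA Ω (fun x => S.eval (invSub z x)) := by
  rw [← planePart_closure] at hz
  refine ⟨⟨fun w hw => ?_, fun _ => ?_⟩, ?_⟩
  · have hw' : w - z ≠ 0 := sub_ne_zero.2 fun e => hz (subset_closure (by rwa [← e]))
    have : DifferentiableAt ℂ (fun w : ℂ => (w - z)⁻¹) w := by fun_prop (disch := assumption)
    exact (S.differentiable _).comp w this
  · simp only [invSub_chartAtInfinity]
    have : DifferentiableAt ℂ (fun ζ : ℂ => ζ / (1 - z * ζ)) 0 := by
      refine DifferentiableAt.div (by fun_prop) (by fun_prop) (by simp)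
    exact (S.differentiable _).comp 0 this
  · intro x hx
    refine (S.continuous.continuousAt.comp (continuousAt_invSub ?_)).continuousWithinAt
    rintro rfl
    exact hz hx

/-- Polar coordinates turn this into ∫ dt / (1 + t²) over t > 0. -/
theorem integrable_inv_norm_mul : Integrable (fun w : ℂ => (‖w‖ * (1 + ‖w‖ ^ 2))⁻¹) := by
  have h := integrable_fun_norm_addHaar (volume : Measure ℂ)
    (f := fun t : ℝ => (t * (1 + t ^ 2))⁻¹)
  rw [h]
  refine (integrable_inv_one_add_sq.integrableOn (s := Ioi (0 : ℝ))).congr_fun (fun t ht => ?_)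
    measurableSet_Ioi
  have ht : (0 : ℝ) < t := ht
  simp only [Complex.finrank_real_complex, smul_eq_mul]
  rw [Nat.add_one_sub_one, pow_one]
  field_simp

/-- In the variable u = 1 / (w - z), u = 0 is the point ∞ and u = -1 / z is the origin, so the two
conditions on `S` are vanishing at ∞ and at 0. Splitting off u (u + 1 / z) = w / (z (w - z)²) bounds
the weighted integrand by a multiple of 1 / (|w| (1 + |w|²)). -/
theorem memLa1_eval_invSub {Ω : Set RSphere} (hΩ : IsOpen Ω) (h0 : ((0 : ℂ) : RSphere) ∈ Ω) {z : ℂ}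
    (hz : z ∉ closure (planePart Ω)) {S : Polynomial ℂ} (hS0 : S.eval 0 = 0)
    (hS : S.eval (-z⁻¹) = 0) : MemLa1 Ω (fun x => S.eval (invSub z x)) := by
  refine ⟨memA_eval_invSub hz S, ?_⟩
  have hz0 : z ≠ 0 := by
    rintro rfl
    exact hz (subset_closure h0)
  obtain ⟨ρ, hρ, hρU⟩ := Metric.isOpen_iff.1 isClosed_closure.isOpen_compl z hz
  have hd : ∀ w ∈ planePart Ω, ρ ≤ ‖w - z‖ := fun w hw => by
    by_contra! hlt
    exact hρU (mem_ball_iff_norm.2 hlt) (subset_closure hw)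
  obtain ⟨S1, rfl⟩ := Polynomial.dvd_iff_isRoot.2 (show S.IsRoot 0 from hS0)
  have hS' : S1.IsRoot (-z⁻¹) := by
    have hz1 : -z⁻¹ ≠ 0 := neg_ne_zero.2 (inv_ne_zero hz0)
    simpa [hz0] using hS
  obtain ⟨S2, rfl⟩ := Polynomial.dvd_iff_isRoot.2 hS'
  obtain ⟨C, hC⟩ := (isCompact_closedBall (0 : ℂ) ρ⁻¹).exists_bound_of_continuousOn
    S2.continuous.continuousOn
  have hUm := (isOpen_planePart hΩ).measurableSet
  set E : ℝ := ‖z‖⁻¹ * (2 + (1 + 2 * ‖z‖ ^ 2) / ρ ^ 2) * C with hE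
  refine (integrable_inv_norm_mul.const_mul E).integrableOn.mono' ?_ ?_
  · have h1 := ((memA_eval_invSub hz ((Polynomial.X - Polynomial.C 0) *
      ((Polynomial.X - Polynomial.C (-z⁻¹)) * S2))).continuousOn.mono subset_closure).aestronglyMeasurable
      (μ := volume) hUm
    have h2 : Measurable (fun w : ℂ => ((‖w‖ ^ 2 : ℝ) : ℂ)) := by fun_prop
    exact (h1.aemeasurable.div h2.aemeasurable).aestronglyMeasurable
  · refine (ae_restrict_iff' hUm).2 (Eventually.of_forall fun w hw => ?_)
    have hρw := hd w hw
    have hwz : 0 < ‖w - z‖ := hρ.trans_le hρw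
    have hwz' : w - z ≠ 0 := norm_pos_iff.1 hwz
    rcases eq_or_ne w 0 with rfl | hw0
    · simp
    have hw0' : 0 < ‖w‖ := norm_pos_iff.2 hw0
    have hz0' : 0 < ‖z‖ := norm_pos_iff.2 hz0
    have hC1 : ‖S2.eval (w - z)⁻¹‖ ≤ C := by
      refine hC _ ?_
      rw [mem_closedBall_zero_iff, norm_inv]
      exact inv_anti₀ hρ hρw
    have hC0 : 0 ≤ C := (norm_nonneg _).trans hC1
    have hfac : (w - z)⁻¹ * ((w - z)⁻¹ + z⁻¹) = w / (z * (w - z) ^ 2) := by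
      field_simp
      ring
    have hq : 1 + ‖w‖ ^ 2 ≤ (2 + (1 + 2 * ‖z‖ ^ 2) / ρ ^ 2) * ‖w - z‖ ^ 2 := by
      have h1 : ‖w‖ ≤ ‖w - z‖ + ‖z‖ := by simpa using norm_add_le (w - z) z
      have h2 : ‖w‖ ^ 2 ≤ 2 * ‖w - z‖ ^ 2 + 2 * ‖z‖ ^ 2 := by
        nlinarith [sq_nonneg (‖w - z‖ - ‖z‖), norm_nonneg w]
      have h3 : 1 + 2 * ‖z‖ ^ 2 ≤ (1 + 2 * ‖z‖ ^ 2) / ρ ^ 2 * ‖w - z‖ ^ 2 := by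
        rw [div_mul_eq_mul_div, le_div_iff₀ (by positivity)]
        gcongr
      linarith
    have e : (((Polynomial.X - Polynomial.C 0) * ((Polynomial.X - Polynomial.C (-z⁻¹)) * S2)).eval
        (invSub z (w : RSphere))) = w / (z * (w - z) ^ 2) * S2.eval (w - z)⁻¹ := by
      rw [← hfac]
      simp
      ring
    simp only [e]
    simp only [norm_mul, norm_div, norm_pow, Complex.norm_real, norm_norm]
    calc ‖w‖ / (‖z‖ * ‖w - z‖ ^ 2) * ‖S2.eval (w - z)⁻¹‖ / ‖w‖ ^ 2
        = ‖z‖⁻¹ * ‖S2.eval (w - z)⁻¹‖ / ‖w‖ * (‖w - z‖ ^ 2)⁻¹ := by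
          field_simp
      _ ≤ ‖z‖⁻¹ * C / ‖w‖ * ((2 + (1 + 2 * ‖z‖ ^ 2) / ρ ^ 2) / (1 + ‖w‖ ^ 2)) := by
          gcongr
          rw [inv_le_iff_one_le_mul₀ (by positivity), div_mul_eq_mul_div, one_le_div (by positivity)]
          exact hq
      _ = E * (‖w‖ * (1 + ‖w‖ ^ 2))⁻¹ := by
          rw [hE]
          field_simp

/-- Quotients `P(w) / (w - z) ^ M` as test functions. -/
theorem exists_memLa1_eq {Ω : Set RSphere} (hΩ : IsOpen Ω) (h0 : ((0 : ℂ) : RSphere) ∈ Ω) {z : ℂ}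
    (hz : z ∉ closure (planePart Ω)) {P : Polynomial ℂ} (hP0 : P.eval 0 = 0) {M : ℕ}
    (hM : P.natDegree < M) :
    ∃ f : RSphere → ℂ, MemLa1 Ω f ∧ ∀ w : ℂ, w ≠ z → f w = P.eval w * ((w - z)⁻¹) ^ M := by
  have hz0 : z ≠ 0 := by
    rintro rfl
    exact hz (subset_closure h0)
  -- The Taylor expansion of `P` at z, multiplied by uᴹ with u = 1 / (w - z). As deg P < M, no
  -- constant term remains and the function vanishes at ∞.
  set S : Polynomial ℂ := ∑ i ∈ Finset.range M,
    Polynomial.C ((Polynomial.taylor z P).coeff i) * Polynomial.X ^ (M - i) with hS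
  have hev : ∀ w : ℂ, w ≠ z → S.eval (w - z)⁻¹ = P.eval w * ((w - z)⁻¹) ^ M := fun w hw => by
    have hw' : w - z ≠ 0 := sub_ne_zero.2 hw
    have h1 : P.eval w = ∑ i ∈ Finset.range M, (Polynomial.taylor z P).coeff i * (w - z) ^ i := by
      rw [← Polynomial.eval_eq_sum_range' (by simpa using hM)]
      simp [Polynomial.taylor_eval]
    rw [hS, h1, Polynomial.eval_finsetSum, Finset.sum_mul]
    refine Finset.sum_congr rfl fun i hi => ?_
    have hi' : i ≤ M := (Finset.mem_range.1 hi).le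
    have h2 : ((w - z)⁻¹) ^ M = ((w - z)⁻¹) ^ i * ((w - z)⁻¹) ^ (M - i) := by
      rw [← pow_add, Nat.add_sub_cancel' hi']
    simp only [Polynomial.eval_mul, Polynomial.eval_C, Polynomial.eval_pow, Polynomial.eval_X]
    rw [h2, mul_assoc, ← mul_assoc ((w - z) ^ i), ← mul_pow, mul_inv_cancel₀ hw', one_pow, one_mul]
  refine ⟨fun x => S.eval (invSub z x), memLa1_eval_invSub hΩ h0 hz ?_ ?_,
    fun w hw => hev w hw⟩
  · rw [hS, Polynomial.eval_finsetSum]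
    refine Finset.sum_eq_zero fun i hi => ?_
    have : M - i ≠ 0 := (Nat.sub_pos_of_lt (Finset.mem_range.1 hi)).ne'
    simp [this]
  · have := hev 0 hz0.symm
    rw [hP0, zero_mul, zero_sub, inv_neg] at this
    exact this

/-! ### Rational functions -/

/-- Degree differences are unchanged by cross-multiplication, so the fraction need not be reduced.
-/
theorem vanishesAtInfinity_div_iff {p q : Polynomial ℂ} (hq : q ≠ 0) :
    VanishesAtInfinity (algebraMap _ (RatFunc ℂ) p / algebraMap _ (RatFunc ℂ) q) ↔
      p.degree < q.degree := by
  set x := algebraMap _ (RatFunc ℂ) p / algebraMap _ (RatFunc ℂ) q with hx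
  have h := (RatFunc.num_mul_eq_mul_denom_iff (x := x) (p := p) hq).2 rfl
  have hd := x.denom_ne_zero
  rw [VanishesAtInfinity]
  rcases eq_or_ne p 0 with rfl | hp
  · have : x = 0 := by simp [hx]
    simp [this, Polynomial.degree_zero, bot_lt_iff_ne_bot, hq]
  · have hn : x.num ≠ 0 := by
      intro h0
      rw [h0, zero_mul] at h
      exact mul_ne_zero hp hd h.symm
    have hdeg := congrArg Polynomial.natDegree h
    rw [Polynomial.natDegree_mul hn hq, Polynomial.natDegree_mul hp hd] at hdeg
    rw [Polynomial.degree_eq_natDegree hn, Polynomial.degree_eq_natDegree hd,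
      Polynomial.degree_eq_natDegree hp, Polynomial.degree_eq_natDegree hq, Nat.cast_lt,
      Nat.cast_lt]
    omega

theorem VanishesAtInfinity.add {x y : RatFunc ℂ} (hx : VanishesAtInfinity x)
    (hy : VanishesAtInfinity y) : VanishesAtInfinity (x + y) := by
  have hxd := x.denom_ne_zero
  have hyd := y.denom_ne_zero
  have e := (RatFunc.num_mul_eq_mul_denom_iff (mul_ne_zero hxd hyd)).1 (RatFunc.num_denom_add x y)
  rw [e, vanishesAtInfinity_div_iff (mul_ne_zero hxd hyd)]
  refine (Polynomial.degree_add_le _ _).trans_lt (max_lt ?_ ?_)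
  · rw [Polynomial.degree_mul, Polynomial.degree_mul]
    exact WithBot.add_lt_add_right (Polynomial.degree_ne_bot.2 hyd) hx
  · rw [Polynomial.degree_mul, Polynomial.degree_mul]
    exact WithBot.add_lt_add_left (Polynomial.degree_ne_bot.2 hxd) hy

theorem VanishesAtInfinity.neg {x : RatFunc ℂ} (hx : VanishesAtInfinity x) :
    VanishesAtInfinity (-x) := by
  have e := (RatFunc.num_mul_eq_mul_denom_iff x.denom_ne_zero).1 (RatFunc.num_denom_neg x)
  rw [e, vanishesAtInfinity_div_iff x.denom_ne_zero, Polynomial.degree_neg]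
  exact hx

theorem ratFunc_C_div_X (q : ℂ) : (RatFunc.C q / RatFunc.X : RatFunc ℂ) =
    algebraMap (Polynomial ℂ) (RatFunc ℂ) (Polynomial.C q) /
      algebraMap (Polynomial ℂ) (RatFunc ℂ) Polynomial.X := by
  rw [RatFunc.algebraMap_C, RatFunc.algebraMap_X]

theorem vanishesAtInfinity_C_div_X (q : ℂ) :
    VanishesAtInfinity (RatFunc.C q / RatFunc.X : RatFunc ℂ) := by
  rw [ratFunc_C_div_X, vanishesAtInfinity_div_iff Polynomial.X_ne_zero, Polynomial.degree_X]
  exact Polynomial.degree_C_le.trans_lt (by norm_num)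

theorem eval_denom_C_div_X_ne_zero (q : ℂ) {w : ℂ} (hw : w ≠ 0) :
    (RatFunc.C q / RatFunc.X : RatFunc ℂ).denom.eval w ≠ 0 := by
  rw [ratFunc_C_div_X]
  intro h
  have hX := Polynomial.eval_eq_zero_of_dvd_of_eval_eq_zero
    (RatFunc.denom_div_dvd (Polynomial.C q) Polynomial.X) h
  exact hw (by simpa using hX)

theorem eval_C_div_X (q : ℂ) {w : ℂ} (hw : w ≠ 0) :
    (RatFunc.C q / RatFunc.X : RatFunc ℂ).eval (RingHom.id ℂ) w = q / w := by
  have hX : (RatFunc.C q / RatFunc.X : RatFunc ℂ) * RatFunc.X = RatFunc.C q :=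
    div_mul_cancel₀ _ RatFunc.X_ne_zero
  have h1 := RatFunc.eval_mul (RingHom.id ℂ) w (x := (RatFunc.C q / RatFunc.X : RatFunc ℂ))
    (y := RatFunc.X) (by
      rw [Polynomial.eval₂_id]
      exact eval_denom_C_div_X_ne_zero q hw) (by simp)
  rw [hX, RatFunc.eval_C, RatFunc.eval_X, RingHom.id_apply] at h1
  exact eq_div_of_mul_eq hw h1.symm

theorem isRoot_denom_add {x y : RatFunc ℂ} {w : ℂ} (h : (x + y).denom.IsRoot w) :
    x.denom.IsRoot w ∨ y.denom.IsRoot w := by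
  have := Polynomial.eval_eq_zero_of_dvd_of_eval_eq_zero (RatFunc.denom_add_dvd x y) h
  rwa [Polynomial.eval_mul, mul_eq_zero] at this

/-! ### The set of quadrature functions -/

namespace IsLQD

variable {Ω : Set RSphere} {g h : RatFunc ℂ} {T : ℂ → ℂ}

theorem eval_denom_ne_zero (hΩ : IsLQD Ω h) {w : ℂ} (hw : w ∈ frontier (planePart Ω)) :
    h.denom.eval w ≠ 0 := fun h0 =>
  ((isOpen_planePart hΩ.isOpen).frontier_eq ▸ hw).2 (hΩ.memRat.1 w h0)

/-- A quadrature function may be modified by a point charge at the origin. -/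
theorem add_C_div_X (hΩ : IsLQD Ω h) (h0 : ((0 : ℂ) : RSphere) ∈ Ω) (q : ℂ) :
    IsLQD Ω (h + RatFunc.C q / RatFunc.X) := by
  have hvan : OnePoint.infty ∉ Ω → VanishesAtInfinity (h + RatFunc.C q / RatFunc.X) :=
    fun hi => (hΩ.vanishes hi).add (vanishesAtInfinity_C_div_X q)
  refine ⟨hΩ.isOpen, hΩ.isConnected, hΩ.interior_closure, hΩ.zero_notMem, hΩ.infty_notMem,
    hΩ.rectifiable, ⟨fun w hw => ?_, fun hlt => ?_⟩, hvan, fun f hf => ?_⟩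
  · rcases isRoot_denom_add hw with hw | hw
    · exact hΩ.memRat.1 w hw
    · have : w = 0 := by
        by_contra hw0
        exact eval_denom_C_div_X_ne_zero q hw0 hw
      rwa [this]
  · by_contra hi
    exact lt_asymm hlt (hvan hi)
  · obtain ⟨T, hT, hTi, hTe⟩ := hΩ.quadrature f hf
    have hG := hΩ.greenTangent hT
    have h0f := zero_notMem_frontier hΩ.isOpen h0
    refine ⟨T, hT, ?_⟩
    rw [planePart_frontier] at hTi hTe ⊢
    have hw0 : ∀ w ∈ frontier (planePart Ω), w ≠ 0 := fun w hw e => h0f (e ▸ hw)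
    have hev : ∀ w ∈ frontier (planePart Ω), f w * (h + RatFunc.C q / RatFunc.X).eval
        (RingHom.id ℂ) w * T w =
        f w * h.eval (RingHom.id ℂ) w * T w + q * (f w / w * T w) := fun w hw => by
      rw [RatFunc.eval_add, eval_C_div_X q (hw0 w hw)]
      · ring
      · rw [Polynomial.eval₂_id]
        exact hΩ.eval_denom_ne_zero hw
      · rw [Polynomial.eval₂_id]
        exact eval_denom_C_div_X_ne_zero q (hw0 w hw)
    have hci : IntegrableOn (fun w : ℂ => q * (f w / w * T w)) (frontier (planePart Ω))
        (Measure.hausdorffMeasure 1 : Measure ℂ) :=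
      (hG.integrableOn ((hf.1.continuousOn.mono frontier_subset_closure).div continuousOn_id
        hw0)).const_mul q
    refine ⟨(hTi.add hci).congr_fun (fun w hw => (hev w hw).symm)
      isClosed_frontier.measurableSet, ?_⟩
    rw [hTe, setIntegral_congr_fun isClosed_frontier.measurableSet hev, integral_add hTi hci,
      integral_const_mul, hf.integral_div_eq_zero hG h0f, mul_zero, add_zero]

/-- Each quadrature identity supplies its own tangent field, depending on f and on the quadrature
function; almost everywhere uniqueness replaces them all by one `T`, and the identities can be
subtracted. -/
theorem integral_mul_eval_sub_eq_zero (hΩ : IsLQD Ω h) (hg : IsLQD Ω g)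
    (hT : IsPositiveTangent Ω T) {f : RSphere → ℂ} (hf : MemLa1 Ω f) :
    ∫ w in frontier (planePart Ω), f w * (g - h).eval (RingHom.id ℂ) w * T w
      ∂(Measure.hausdorffMeasure 1 : Measure ℂ) = 0 := by
  have hcoef : (1 / (2 * (Real.pi : ℂ) * Complex.I)) ≠ 0 := by
    simp [Real.pi_ne_zero]
  have key : ∀ x : RatFunc ℂ, IsLQD Ω x →
      IntegrableOn (fun w : ℂ => f w * x.eval (RingHom.id ℂ) w * T w)
        (frontier (planePart Ω)) (Measure.hausdorffMeasure 1 : Measure ℂ) ∧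
      logWeightedIntegral Ω f = (1 / (2 * (Real.pi : ℂ) * Complex.I)) *
        ∫ w in frontier (planePart Ω), f w * x.eval (RingHom.id ℂ) w * T w
          ∂(Measure.hausdorffMeasure 1 : Measure ℂ) := fun x hx => by
    obtain ⟨T1, hT1, hi, he⟩ := hx.quadrature f hf
    have hae := hx.tangent_ae_eq hT1 hT
    rw [planePart_frontier] at hi he hae
    have hae' : (fun w : ℂ => f w * x.eval (RingHom.id ℂ) w * T1 w)
        =ᵐ[(Measure.hausdorffMeasure 1 : Measure ℂ).restrict (frontier (planePart Ω))]
        fun w : ℂ => f w * x.eval (RingHom.id ℂ) w * T w := by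
      filter_upwards [hae] with w hw
      rw [hw]
    exact ⟨hi.congr hae', by rw [he, integral_congr_ae hae']⟩
  obtain ⟨hi1, he1⟩ := key h hΩ
  obtain ⟨hi2, he2⟩ := key g hg
  have hev : ∀ w ∈ frontier (planePart Ω), f w * (g - h).eval (RingHom.id ℂ) w * T w =
      f w * g.eval (RingHom.id ℂ) w * T w - f w * h.eval (RingHom.id ℂ) w * T w := fun w hw => by
    have hgh : (g - h).denom.eval w ≠ 0 := by
      intro h0
      rw [sub_eq_add_neg] at h0
      rcases isRoot_denom_add h0 with h1 | h1
      · exact hg.eval_denom_ne_zero hw h1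
      · have e := (RatFunc.num_mul_eq_mul_denom_iff h.denom_ne_zero).1 (RatFunc.num_denom_neg h)
        rw [e] at h1
        exact hΩ.eval_denom_ne_zero hw
          (Polynomial.eval_eq_zero_of_dvd_of_eval_eq_zero (RatFunc.denom_div_dvd _ _) h1)
    have h2 : g.eval (RingHom.id ℂ) w = (g - h).eval (RingHom.id ℂ) w + h.eval (RingHom.id ℂ) w := by
      rw [← RatFunc.eval_add, sub_add_cancel]
      · rwa [Polynomial.eval₂_id]
      · rw [Polynomial.eval₂_id]
        exact hΩ.eval_denom_ne_zero hw
    rw [h2]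
    ring
  rw [setIntegral_congr_fun isClosed_frontier.measurableSet hev, integral_sub hi2 hi1, sub_eq_zero]
  exact mul_left_cancel₀ hcoef (he2.symm.trans he1)

end IsLQD

/-! ### Residues -/

section Residue

variable {Ω : Set RSphere} {T : ℂ → ℂ} {z : ℂ}

/-- A rational function with poles off the closure and a double zero at infinity has vanishing
boundary integral. -/
theorem integral_eval_mul_pow_eq_zero (hΩ : IsOpen Ω) (h0 : ((0 : ℂ) : RSphere) ∈ Ω)
    (hT : GreenTangent (planePart Ω) T) (hz : z ∉ closure (planePart Ω)) {R : Polynomial ℂ} {M : ℕ}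
    (hM : R.natDegree + 2 ≤ M) :
    ∫ w in frontier (planePart Ω), R.eval w * ((w - z)⁻¹) ^ M * T w
      ∂(Measure.hausdorffMeasure 1 : Measure ℂ) = 0 := by
  have hd : (Polynomial.X * R).natDegree < M := by
    have := Polynomial.natDegree_mul_le (p := (Polynomial.X : Polynomial ℂ)) (q := R)
    rw [Polynomial.natDegree_X] at this
    omega
  have h0f := zero_notMem_frontier hΩ h0
  -- The integrand is f / w for a test function f, so invisibility of point charges already gives
  -- the vanishing.
  obtain ⟨f, hf, hfe⟩ := exists_memLa1_eq hΩ h0 hz (P := Polynomial.X * R) (by simp) hd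
  rw [← hf.integral_div_eq_zero hT h0f]
  refine setIntegral_congr_fun isClosed_frontier.measurableSet fun w hw => ?_
  have hw0 : w ≠ 0 := fun e => h0f (e ▸ hw)
  have hwz : w ≠ z := fun e => hz (frontier_subset_closure (e ▸ hw))
  simp only [hfe w hwz, Polynomial.eval_mul, Polynomial.eval_X]
  field_simp

theorem continuousOn_inv_sub_frontier {U : Set ℂ} {p : ℂ} (hp : p ∉ frontier U) :
    ContinuousOn (fun w => (w - p)⁻¹) (frontier U) :=
  ContinuousOn.inv₀ (by fun_prop) fun w hw => sub_ne_zero.2 fun e => hp (e ▸ hw)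

/-- A rational function whose only pole in the domain is simple and whose boundary integral
vanishes has residue zero. -/
theorem eval_eq_zero_of_integral_eq_zero (hΩ : IsOpen Ω) (h0 : ((0 : ℂ) : RSphere) ∈ Ω)
    (hT : GreenTangent (planePart Ω) T)
    (hb : Bornology.IsBounded (planePart Ω) ∨ Bornology.IsBounded (planePart Ω)ᶜ)
    (hz : z ∉ closure (planePart Ω)) {N : Polynomial ℂ} {M : ℕ} (hM : N.natDegree < M)
    (hM2 : 2 ≤ M) {p : ℂ} (hp : p ∈ planePart Ω)
    (hI : ∫ w in frontier (planePart Ω), N.eval w * ((w - z)⁻¹) ^ M * (w - p)⁻¹ * T w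
      ∂(Measure.hausdorffMeasure 1 : Measure ℂ) = 0) : N.eval p = 0 := by
  have hpz : p - z ≠ 0 := sub_ne_zero.2 fun e => hz (subset_closure (e ▸ hp))
  have hzf : z ∉ frontier (planePart Ω) := fun hf => hz (frontier_subset_closure hf)
  have hpf : p ∉ frontier (planePart Ω) := fun hf => (hT.isOpen.frontier_eq ▸ hf).2 hp
  -- Chosen so that N - A (w - z)^(M-1) vanishes at p. What is left is a pole-free part with a
  -- double zero at ∞ plus A / ((w - z)(w - p)).
  set A : ℂ := N.eval p / (p - z) ^ (M - 1) with hA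
  set Q : Polynomial ℂ := N - Polynomial.C A * (Polynomial.X - Polynomial.C z) ^ (M - 1) with hQ
  have hQp : Q.IsRoot p := by
    simp [hQ, hA, Polynomial.IsRoot, div_mul_cancel₀ _ (pow_ne_zero (M - 1) hpz)]
  have hQd : Q.natDegree ≤ M - 1 := by
    refine (Polynomial.natDegree_sub_le _ _).trans (max_le (by omega) ?_)
    refine (Polynomial.natDegree_C_mul_le _ _).trans (Polynomial.natDegree_pow_le.trans ?_)
    rw [Polynomial.natDegree_X_sub_C, mul_one]
  obtain ⟨R, hR⟩ := Polynomial.dvd_iff_isRoot.2 hQp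
  have hRd : R.natDegree + 2 ≤ M := by
    rcases eq_or_ne R 0 with rfl | hR0
    · simpa using hM2
    · rw [hR, Polynomial.natDegree_mul (Polynomial.X_sub_C_ne_zero p) hR0,
        Polynomial.natDegree_X_sub_C] at hQd
      omega
  have hev : ∀ w ∈ frontier (planePart Ω), N.eval w * ((w - z)⁻¹) ^ M * (w - p)⁻¹ * T w =
      R.eval w * ((w - z)⁻¹) ^ M * T w +
        A / (p - z) * (((w - p)⁻¹ - (w - z)⁻¹) * T w) := fun w hw => by
    have hwp : w - p ≠ 0 := sub_ne_zero.2 fun e => hpf (e ▸ hw)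
    have hwz : w - z ≠ 0 := sub_ne_zero.2 fun e => hzf (e ▸ hw)
    have h1 : N.eval w = (w - p) * R.eval w + A * (w - z) ^ (M - 1) := by
      have := congrArg (Polynomial.eval w) hR
      simp only [hQ, Polynomial.eval_sub, Polynomial.eval_mul, Polynomial.eval_C,
        Polynomial.eval_pow, Polynomial.eval_X] at this
      linear_combination this
    have h2 : (w - z) ^ (M - 1) * ((w - z)⁻¹) ^ M = (w - z)⁻¹ := by
      obtain ⟨m, rfl⟩ : ∃ m, M = m + 1 := ⟨M - 1, by omega⟩
      rw [Nat.add_sub_cancel, pow_succ, ← mul_assoc, ← mul_pow, mul_inv_cancel₀ hwz, one_pow,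
        one_mul]
    have h3 : (w - z)⁻¹ * (w - p)⁻¹ = 1 / (p - z) * ((w - p)⁻¹ - (w - z)⁻¹) := by
      field_simp
      ring
    have h4 : (w - p) * (w - p)⁻¹ = 1 := mul_inv_cancel₀ hwp
    rw [h1]
    linear_combination R.eval w * ((w - z)⁻¹) ^ M * T w * h4 + A * (w - p)⁻¹ * T w * h2 +
      A * T w * h3
  have hc := continuousOn_inv_sub_frontier hzf
  rw [setIntegral_congr_fun isClosed_frontier.measurableSet hev, integral_add,
    integral_eval_mul_pow_eq_zero hΩ h0 hT hz hRd, zero_add, integral_const_mul, mul_eq_zero] at hI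
  · have hA0 := hI.resolve_right (hT.integral_inv_sub_sub_inv_sub_ne_zero hb hp hz)
    simpa [hA, hpz] using hA0
  · exact hT.integrableOn (R.continuous.continuousOn.mul (hc.pow M))
  · exact (hT.integrableOn ((continuousOn_inv_sub_frontier hpf).sub hc)).const_mul _

end Residue

/-- The rational functions orthogonal to the test class: all their poles in the plane are simple
and at the origin. -/
theorem denom_dvd_X {Ω : Set RSphere} {T : ℂ → ℂ} {z : ℂ} (hΩ : IsOpen Ω)
    (h0 : ((0 : ℂ) : RSphere) ∈ Ω) (hT : GreenTangent (planePart Ω) T)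
    (hb : Bornology.IsBounded (planePart Ω) ∨ Bornology.IsBounded (planePart Ω)ᶜ)
    (hz : z ∉ closure (planePart Ω)) {n d : Polynomial ℂ} (hnd : IsCoprime n d)
    (hroot : ∀ p, d.IsRoot p → p ∈ planePart Ω)
    (horth : ∀ f : RSphere → ℂ, MemLa1 Ω f →
      ∫ w in frontier (planePart Ω), f w * (n.eval w / d.eval w) * T w
        ∂(Measure.hausdorffMeasure 1 : Measure ℂ) = 0) : d ∣ Polynomial.X := by
  -- With P = d c / (w - p), testing n / d against P / (w - z)^M leaves c n / (w - z)^M with a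
  -- simple pole at p; so c n vanishes at p, and n does not by coprimality.
  have hres : ∀ (p : ℂ) (c P : Polynomial ℂ), d.IsRoot p →
      P * (Polynomial.X - Polynomial.C p) = d * c → P.eval 0 = 0 → c.eval p = 0 := by
    intro p c P hp hP hP0
    set M := max P.natDegree (c * n).natDegree + 2 with hM
    obtain ⟨f, hf, hfe⟩ := exists_memLa1_eq hΩ h0 hz hP0 (M := M) (by omega)
    have hI := horth f hf
    have hcn : (c * n).eval p = 0 := by
      refine eval_eq_zero_of_integral_eq_zero hΩ h0 hT hb hz (M := M) (by omega) (by omega)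
        (hroot p hp) ?_
      rw [← hI]
      refine setIntegral_congr_fun isClosed_frontier.measurableSet fun w hw => ?_
      have hwU : w ∉ planePart Ω := (hT.isOpen.frontier_eq ▸ hw).2
      have hwz : w ≠ z := fun e => hz (frontier_subset_closure (e ▸ hw))
      have hwp : w - p ≠ 0 := sub_ne_zero.2 fun e => hwU (e ▸ hroot p hp)
      have hdw : d.eval w ≠ 0 := fun e => hwU (hroot w e)
      have hPw : P.eval w * (w - p) = d.eval w * c.eval w := by
        simpa using congrArg (Polynomial.eval w) hP
      have hPw' : P.eval w / d.eval w = c.eval w * (w - p)⁻¹ := by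
        rw [div_eq_iff hdw, mul_right_comm, eq_mul_inv_iff_mul_eq₀ hwp, hPw, mul_comm]
      simp only [hfe w hwz, Polynomial.eval_mul]
      linear_combination -(n.eval w * ((w - z)⁻¹) ^ M * T w) * hPw'
    rw [Polynomial.eval_mul, mul_eq_zero] at hcn
    refine hcn.resolve_right fun hn => ?_
    obtain ⟨a, b, hab⟩ := hnd
    have := congrArg (Polynomial.eval p) hab
    have hdp : d.eval p = 0 := hp
    simp [hn, hdp] at this
  have hroot0 : ∀ p, d.IsRoot p → p = 0 := fun p hp => by
    obtain ⟨e, he⟩ := Polynomial.dvd_iff_isRoot.2 hp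
    -- The choice c = w secures P(0) = 0 and yields p = 0.
    have := hres p Polynomial.X (Polynomial.X * e) hp (by rw [he]; ring) (by simp)
    simpa using this
  by_cases hd : d.degree = 0
  · exact (Polynomial.isUnit_iff_degree_eq_zero.2 hd).dvd
  obtain ⟨p, hp⟩ := IsAlgClosed.exists_root d hd
  obtain rfl := hroot0 p hp
  obtain ⟨e, he⟩ := Polynomial.dvd_iff_isRoot.2 hp
  rw [Polynomial.C_0, sub_zero] at he
  have hedeg : e.degree = 0 := by
    by_contra hne
    obtain ⟨q, hq⟩ := IsAlgClosed.exists_root e hne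
    have hqd : d.IsRoot q := by
      rw [he]
      exact hq.dvd (Dvd.intro_left _ rfl)
    obtain rfl := hroot0 q hqd
    obtain ⟨e', he'⟩ := Polynomial.dvd_iff_isRoot.2 hq
    rw [Polynomial.C_0, sub_zero] at he'
    -- If w² divides d, then P = d / w still vanishes at 0, so c = 1 is allowed, which is absurd.
    have := hres 0 1 (Polynomial.X * e') hp (by rw [he, he', Polynomial.C_0]; ring) (by simp)
    simp at this
  obtain ⟨v, hv⟩ := (Polynomial.isUnit_iff_degree_eq_zero.2 hedeg).exists_right_inv
  exact ⟨v, by rw [he, mul_assoc, hv, mul_one]⟩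

/-- If the domain contains infinity, a rational function orthogonal to the test class has no pole
there. -/
theorem natDegree_eq_zero_of_infty_mem {Ω : Set RSphere} {T : ℂ → ℂ} {z : ℂ} (hΩ : IsOpen Ω)
    (h0 : ((0 : ℂ) : RSphere) ∈ Ω) (hT : GreenTangent (planePart Ω) T)
    (hb : Bornology.IsBounded (planePart Ω)ᶜ)
    (hz : z ∉ closure (planePart Ω)) {m : Polynomial ℂ}
    (horth : ∀ f : RSphere → ℂ, MemLa1 Ω f →
      ∫ w in frontier (planePart Ω), f w * (m.eval w / w) * T w
        ∂(Measure.hausdorffMeasure 1 : Measure ℂ) = 0) : m.natDegree = 0 := by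
  by_contra hD
  have h0f := zero_notMem_frontier hΩ h0
  have hzf : z ∉ frontier (planePart Ω) := fun hf => hz (frontier_subset_closure hf)
  set D := m.natDegree with hDdef
  have hm : m ≠ 0 := fun e => hD (by simp [hDdef, e])
  set c := m.leadingCoeff with hc
  have hc0 : c ≠ 0 := Polynomial.leadingCoeff_ne_zero.2 hm
  set R := m - Polynomial.C c * (Polynomial.X - Polynomial.C z) ^ D with hR
  have hRd : R.natDegree + 2 ≤ D + 1 := by
    have hmon : ((Polynomial.X - Polynomial.C z) ^ D).Monic := (Polynomial.monic_X_sub_C z).pow D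
    have hdeg : (Polynomial.C c * (Polynomial.X - Polynomial.C z) ^ D).degree = m.degree := by
      rw [Polynomial.degree_C_mul hc0, Polynomial.degree_pow, Polynomial.degree_X_sub_C,
        Polynomial.degree_eq_natDegree hm]
      simp [hDdef]
    have hlt : R.degree < m.degree := Polynomial.degree_sub_lt_left hdeg.symm hm (by
      rw [Polynomial.leadingCoeff_mul, hmon.leadingCoeff, Polynomial.leadingCoeff_C, mul_one])
    rcases eq_or_ne R 0 with hR0 | hR0
    · rw [hR0, Polynomial.natDegree_zero]
      omega
    · have := Polynomial.natDegree_lt_natDegree hR0 hlt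
      omega
  -- Against m / w this gives m / (w - z)^(D+1), whose 1 / (w - z) term is the leading coefficient.
  -- Admissibility 1 < D + 1 is where D ≠ 0 enters.
  obtain ⟨f, hf, hfe⟩ := exists_memLa1_eq hΩ h0 hz (P := Polynomial.X) (M := D + 1) (by simp)
    (by rw [Polynomial.natDegree_X]; omega)
  have hI := horth f hf
  have hev : ∀ w ∈ frontier (planePart Ω), f w * (m.eval w / w) * T w =
      R.eval w * ((w - z)⁻¹) ^ (D + 1) * T w + c * ((w - z)⁻¹ * T w) := fun w hw => by
    have hw0 : w ≠ 0 := fun e => h0f (e ▸ hw)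
    have hwz : w - z ≠ 0 := sub_ne_zero.2 fun e => hzf (e ▸ hw)
    have h1 : m.eval w = R.eval w + c * (w - z) ^ D := by simp [hR]
    have h2 : (w - z) ^ D * ((w - z)⁻¹) ^ (D + 1) = (w - z)⁻¹ := by
      rw [pow_succ, ← mul_assoc, ← mul_pow, mul_inv_cancel₀ hwz, one_pow, one_mul]
    have h3 : w * (m.eval w / w) = m.eval w := mul_div_cancel₀ _ hw0
    rw [hfe w (sub_ne_zero.1 hwz), Polynomial.eval_X]
    linear_combination ((w - z)⁻¹) ^ (D + 1) * T w * h3 + ((w - z)⁻¹) ^ (D + 1) * T w * h1 +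
      c * T w * h2
  have hcz := continuousOn_inv_sub_frontier hzf
  rw [setIntegral_congr_fun isClosed_frontier.measurableSet hev, integral_add,
    integral_eval_mul_pow_eq_zero hΩ h0 hT hz hRd, zero_add, integral_const_mul, mul_eq_zero] at hI
  · exact hI.elim hc0 (hT.integral_inv_sub_ne_zero_of_isBounded_compl hb hz)
  · exact hT.integrableOn (R.continuous.continuousOn.mul (hcz.pow (D + 1)))
  · exact (hT.integrableOn hcz).const_mul _

/-- Two quadrature functions differ by a point charge at the origin. -/
theorem IsLQD.exists_eq_add_C_div_X {Ω : Set RSphere} {g h : RatFunc ℂ} (hΩ : IsLQD Ω h)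
    (hg : IsLQD Ω g) (h0 : ((0 : ℂ) : RSphere) ∈ Ω) (hne : Ω ≠ univ) :
    ∃ q : ℂ, g = h + RatFunc.C q / RatFunc.X := by
  have hzero : MemLa1 Ω fun _ => 0 :=
    ⟨⟨⟨fun _ _ => differentiableAt_const _, fun _ => differentiableAt_const _⟩,
      continuousOn_const⟩, by simp [IntegrableOn]⟩
  -- The zero test function serves only to produce a tangent field.
  obtain ⟨T, hT, -⟩ := hΩ.quadrature _ hzero
  have hG := hΩ.greenTangent hT
  obtain ⟨z, hz⟩ := hΩ.exists_notMem_closure hne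
  have horth : ∀ f : RSphere → ℂ, MemLa1 Ω f →
      ∫ w in frontier (planePart Ω), f w * ((g - h).num.eval w / (g - h).denom.eval w) * T w
        ∂(Measure.hausdorffMeasure 1 : Measure ℂ) = 0 := fun f hf => by
    simpa only [RatFunc.eval, Polynomial.eval₂_id] using
      hΩ.integral_mul_eval_sub_eq_zero hg hT hf
  have hroot : ∀ p, (g - h).denom.IsRoot p → p ∈ planePart Ω := fun p hp => by
    rw [sub_eq_add_neg] at hp
    rcases isRoot_denom_add hp with h1 | h1
    · exact hg.memRat.1 p h1
    · have e := (RatFunc.num_mul_eq_mul_denom_iff h.denom_ne_zero).1 (RatFunc.num_denom_neg h)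
      rw [e] at h1
      exact hΩ.memRat.1 p
        (Polynomial.eval_eq_zero_of_dvd_of_eval_eq_zero (RatFunc.denom_div_dvd _ _) h1)
  have hdvd := denom_dvd_X hΩ.isOpen h0 hG hΩ.isBounded_or hz (g - h).isCoprime_num_denom hroot
    horth
  obtain ⟨m, hm⟩ := (RatFunc.denom_dvd Polynomial.X_ne_zero).1 hdvd
  have hm0 : m.natDegree = 0 := by
    by_cases hi : OnePoint.infty ∈ Ω
    · refine natDegree_eq_zero_of_infty_mem hΩ.isOpen h0 hG (hΩ.isBounded_compl hi) hz
        fun f hf => ?_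
      rw [← horth f hf]
      refine setIntegral_congr_fun isClosed_frontier.measurableSet fun w hw => ?_
      have hwU : w ∉ planePart Ω := (hG.isOpen.frontier_eq ▸ hw).2
      have hw0 : w ≠ 0 := fun e => hwU (e ▸ h0)
      have hdw : (g - h).denom.eval w ≠ 0 := fun e => hwU (hroot w e)
      have h1 := congrArg (Polynomial.eval w)
        ((RatFunc.num_mul_eq_mul_denom_iff Polynomial.X_ne_zero).2 hm)
      simp only [Polynomial.eval_mul, Polynomial.eval_X] at h1
      have h2 : m.eval w / w = (g - h).num.eval w / (g - h).denom.eval w := by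
        rw [div_eq_div_iff hw0 hdw, h1]
      simp only [h2]
    · have hv : VanishesAtInfinity (g - h) := by
        rw [sub_eq_add_neg]
        exact (hg.vanishes hi).add (hΩ.vanishes hi).neg
      rw [hm, vanishesAtInfinity_div_iff Polynomial.X_ne_zero] at hv
      rcases eq_or_ne m 0 with hm' | hm'
      · rw [hm', Polynomial.natDegree_zero]
      · have := Polynomial.natDegree_lt_natDegree hm' hv
        rwa [Polynomial.natDegree_X, Nat.lt_one_iff] at this
  refine ⟨m.coeff 0, ?_⟩
  rw [ratFunc_C_div_X, ← Polynomial.eq_C_of_natDegree_eq_zero hm0, ← hm, add_sub_cancel]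

theorem corollary2p2 (Ω : Set RSphere) (h : RatFunc ℂ) (hΩ : IsLQD Ω h)
    (h0 : ((0 : ℂ) : RSphere) ∈ Ω) (hne : Ω ≠ Set.univ) :
    {g : RatFunc ℂ | IsLQD Ω g} =
      {g : RatFunc ℂ | ∃ q : ℂ, g = h + RatFunc.C q / RatFunc.X} := by
  ext g
  constructor
  · exact fun hg => hΩ.exists_eq_add_C_div_X hg h0 hne
  · rintro ⟨q, rfl⟩
    exact hΩ.add_C_div_X h0 q
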